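/- Conventions. Let $(M,J,g)$ be a Hermitian manifold of complex dimension $n$, with $\omega=\sqrt{-1}\,g_{i\bar j}\,dz^i\wedge d\bar z^j$ in holomorphic coordinates. Let $\Gamma_{ki}^{j}=g^{j\bar m}\partial_k g_{i\bar m}$ be the Chern connection, $T_{ij}^{k}=\Gamma_{ij}^k-\Gamma_{ji}^k$ its torsion, $T_{ij\bar k}=T_{ij}^l g_{l\bar k}$, and $R_{i\bar jk\bar l}=-(\partial_{\bar j}\Gamma_{ik}^m)\,g_{m\bar l}$ its curvature. Put $$Q_{i\bar jk\bar l}=R_{i\bar jk\bar l}-g^{p\bar q}\,T_{kp\bar j}\,\overline{T_{lq\bar i}} .$$ The metric is *$Q$-nonnegative* if in every orthonormal frame ($g_{i\bar j}=\delta_{ij}$) and for all real $\lambda_1,\dots,\lambda_n$ one has $\sum_{k,m}Q_{m\bar mk\bar k}(\lambda_k^2-\lambda_k\lambda_m)\ge 0$. A Kähler metric has *nonnegative quadratic orthogonal bisectional curvature* if in every orthonormal frame and for all real $\lambda_1,\dots,\lambda_n$ one has $\sum_{k,m}R_{m\bar mk\bar k}(\lambda_m-\lambda_k)^2\ge 0$.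 A compact Hermitian manifold $(M,J,g)$ is *Vaisman* if there is a closed real 1-form $\theta$ with $d\omega=\theta\wedge\omega$ and $\nabla^{LC}\theta=0$, where $\nabla^{LC}$ is the Levi-Civita connection of $g$. A *Kähler cover* of $(M,J,g)$ is a holomorphic covering $\pi:\tilde M\to M$ (a surjective covering map that is a local biholomorphism) together with a Kähler metric $\tilde\omega=e^{f}\pi^*\omega$ on $\tilde M$, where $f:\tilde M\to\mathbb R$. In particular, every Kähler cyclic cover (one whose deck group is infinite cyclic) is such a cover. **Theorem.** 1. Let $(M,J,g)$ be a Vaisman manifold and $\pi:(\tilde M,\tilde\omega)\to M$ a Kähler cover, for example its Kähler cyclic cover. If $\tilde\omega$ has nonnegative quadratic orthogonal bisectional curvature, then $(M,J,g)$ is $Q$-nonnegative. 2. Let $\alpha_1,\dots,\alpha_n\in\mathbb C$ with $0<|\alpha_1|=\cdots=|\alpha_n|<1$, and let $M_\alpha=(\mathbb C^n\setminus\{0\})/\!\sim$ be the diagonal Hopf manifold, where $\sim$ is the equivalence relation generated by $(z_1,\dots,z_n)\sim(\alpha_1z_1,\dots,\alpha_nz_n)$. Then $M_\alpha$ is compact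 and Hausdorff, the form $\dfrac{4\sqrt{-1}\,\partial\bar\partial|z|^2}{|z|^2}$ descends to the fundamental form of a Hermitian metric on $M_\alpha$, and this metric is Vaisman and $Q$-nonnegative. -/

import Mathlib

open scoped Manifold ContDiff Topology ComplexConjugate

noncomputable section

namespace QPositivity

/-- The model space `ℂⁿ`. -/
abbrev Cn (n : ℕ) : Type := EuclideanSpace ℂ (Fin n)

/-! ### Local Hermitian geometry on an open subset of `ℂⁿ`

A Hermitian metric in holomorphic coordinates is a matrix-valued function `G` with
`G z i j = g_{i \bar j}(z)`. -/

/-- The coordinate vector `e_i` of `ℂⁿ`. -/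
def unitVec {n : ℕ} (i : Fin n) : Cn n := EuclideanSpace.single i 1

/-- `∂F/∂zⁱ = ½ (∂F/∂xⁱ - √-1 ∂F/∂yⁱ)`. -/
def dZ {n : ℕ} (i : Fin n) (F : Cn n → ℂ) (z : Cn n) : ℂ :=
  (1 / 2) * (fderiv ℝ F z (unitVec i) - Complex.I * fderiv ℝ F z (Complex.I • unitVec i))

/-- `∂F/∂\bar zⁱ = ½ (∂F/∂xⁱ + √-1 ∂F/∂yⁱ)`. -/
def dZbar {n : ℕ} (i : Fin n) (F : Cn n → ℂ) (z : Cn n) : ℂ :=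
  (1 / 2) * (fderiv ℝ F z (unitVec i) + Complex.I * fderiv ℝ F z (Complex.I • unitVec i))

/-- A matrix-valued function on `ℂⁿ`, to be thought of as `g_{i \bar j}`. -/
abbrev MetricField (n : ℕ) : Type := Cn n → Matrix (Fin n) (Fin n) ℂ

/-- The inverse metric `g^{i \bar j}`, normalised by `∑ₘ g^{i \bar m} g_{k \bar m} = δ_{ik}`. -/
def invMetric {n : ℕ} (G : MetricField n) (z : Cn n) (i j : Fin n) : ℂ := (G z)⁻¹ j i

/-- Chern connection coefficients `Γ_{ki}^j = g^{j \bar m} ∂_k g_{i \bar m}`. -/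
def chernGamma {n : ℕ} (G : MetricField n) (z : Cn n) (k i j : Fin n) : ℂ :=
  ∑ m, invMetric G z j m * dZ k (fun w => G w i m) z

/-- Chern torsion `T_{ij}^k = Γ_{ij}^k - Γ_{ji}^k`. -/
def chernTorsion {n : ℕ} (G : MetricField n) (z : Cn n) (i j k : Fin n) : ℂ :=
  chernGamma G z i j k - chernGamma G z j i k

/-- Chern torsion with lowered index, `T_{ij \bar k} = T_{ij}^l g_{l \bar k}`. -/
def chernTorsionLow {n : ℕ} (G : MetricField n) (z : Cn n) (i j k : Fin n) : ℂ :=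
  ∑ l, chernTorsion G z i j l * G z l k

/-- Chern curvature `R_{i \bar j k \bar l} = R_{i \bar j k}^m g_{m \bar l}`, where
`R_{i \bar j k}^m = - ∂_{\bar j} Γ_{ik}^m`. -/
def chernCurv {n : ℕ} (G : MetricField n) (z : Cn n) (i j k l : Fin n) : ℂ :=
  ∑ m, -dZbar j (fun w => chernGamma G w i k m) z * G z m l

/-- `Q_{i \bar j k \bar l} = R_{i \bar j k \bar l} - g^{p \bar q} T_{kp \bar j} \bar{T_{lq \bar i}}`. -/
def tensorQ {n : ℕ} (G : MetricField n) (z : Cn n) (i j k l : Fin n) : ℂ :=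
  chernCurv G z i j k l -
    ∑ p, ∑ q, invMetric G z p q * chernTorsionLow G z k p j * conj (chernTorsionLow G z l q i)

/-- `A(u, \bar u, v, \bar v)` for a 4-tensor with components `A_{i \bar j k \bar l}`. -/
def evalDiag {n : ℕ} (A : Fin n → Fin n → Fin n → Fin n → ℂ) (u v : Cn n) : ℂ :=
  ∑ i, ∑ j, ∑ k, ∑ l, A i j k l * u i * conj (u j) * v k * conj (v l)

/-- The sesquilinear form `h(u, v) = g_{i \bar j} uⁱ \bar{vʲ}`. -/
def herm {n : ℕ} (G : MetricField n) (z u v : Cn n) : ℂ :=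
  ∑ i, ∑ j, G z i j * u i * conj (v j)

/-- `ε₁, …, εₙ` is an orthonormal frame of `T^{1,0}` at `z`. -/
def IsUnitaryFrame {n : ℕ} (G : MetricField n) (z : Cn n) (ε : Fin n → Cn n) : Prop :=
  ∀ a b, herm G z (ε a) (ε b) = if a = b then 1 else 0

/-! ### Local real geometry

Real tensors are written in the real coordinate frame `∂/∂x¹, …, ∂/∂xⁿ, ∂/∂y¹, …, ∂/∂yⁿ`. -/

/-- The real coordinate frame: `inl i` stands for `∂/∂xⁱ`, `inr i` for `∂/∂yⁱ = J ∂/∂xⁱ`. -/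
def realVec {n : ℕ} : Fin n ⊕ Fin n → Cn n
  | Sum.inl i => unitVec i
  | Sum.inr i => Complex.I • unitVec i

/-- Partial derivative of a real function along a vector of the real coordinate frame. -/
def dR {n : ℕ} (a : Fin n ⊕ Fin n) (F : Cn n → ℝ) (z : Cn n) : ℝ := fderiv ℝ F z (realVec a)

/-- The Riemannian metric `2 Re h`. -/
def riem {n : ℕ} (G : MetricField n) (z : Cn n) : Matrix (Fin n ⊕ Fin n) (Fin n ⊕ Fin n) ℝ :=
  fun a b => 2 * (herm G z (realVec a) (realVec b)).re

/-- The fundamental form `ω = √-1 g_{i \bar j} dzⁱ ∧ d\bar zʲ = -2 Im h`. -/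
def fundForm {n : ℕ} (G : MetricField n) (z : Cn n) (a b : Fin n ⊕ Fin n) : ℝ :=
  -2 * (herm G z (realVec a) (realVec b)).im

/-- Components of `dω`. -/
def dFundForm {n : ℕ} (G : MetricField n) (z : Cn n) (a b c : Fin n ⊕ Fin n) : ℝ :=
  dR a (fun w => fundForm G w b c) z + dR b (fun w => fundForm G w c a) z +
    dR c (fun w => fundForm G w a b) z

/-- Christoffel symbols `Γ_{ab}^c` of the Levi-Civita connection of `2 Re h`. -/
def christoffel {n : ℕ} (G : MetricField n) (z : Cn n) (a b c : Fin n ⊕ Fin n) : ℝ :=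
  (1 / 2) * ∑ d, (riem G z)⁻¹ c d *
    (dR a (fun w => riem G w b d) z + dR b (fun w => riem G w a d) z -
      dR d (fun w => riem G w a b) z)

/-- The real components of a 1-form in coordinates. -/
abbrev CovectorField (n : ℕ) : Type := Cn n → Fin n ⊕ Fin n → ℝ

/-- Components of `dθ`. -/
def dCovector {n : ℕ} (θ : CovectorField n) (z : Cn n) (a b : Fin n ⊕ Fin n) : ℝ :=
  dR a (fun w => θ w b) z - dR b (fun w => θ w a) z

/-- Components of `θ ∧ ω`. -/
def wedgeFund {n : ℕ} (θ : CovectorField n) (G : MetricField n) (z : Cn n)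
    (a b c : Fin n ⊕ Fin n) : ℝ :=
  θ z a * fundForm G z b c + θ z b * fundForm G z c a + θ z c * fundForm G z a b

/-- Components `(∇_a θ)_b = ∂_a θ_b - Γ_{ab}^c θ_c` of the Levi-Civita derivative of `θ`. -/
def nablaCovector {n : ℕ} (G : MetricField n) (θ : CovectorField n) (z : Cn n)
    (a b : Fin n ⊕ Fin n) : ℝ :=
  dR a (fun w => θ w b) z - ∑ c, christoffel G z a b c * θ z c

/-! ### Hermitian metrics and 1-forms on complex manifolds -/

/-- The holomorphic coordinate systems of a complex manifold of dimension `n`. -/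
abbrev holoCharts (n : ℕ) (M : Type*) [TopologicalSpace M] [ChartedSpace (Cn n) M] :
    Set (OpenPartialHomeomorph M (Cn n)) :=
  IsManifold.maximalAtlas 𝓘(ℂ, Cn n) ω M

/-- The tangent vector at `e.symm z` which has coordinates `v` in the chart `e`. -/
def tangentOf {n : ℕ} {M : Type*} [TopologicalSpace M] [ChartedSpace (Cn n) M]
    (e : OpenPartialHomeomorph M (Cn n)) (z v : Cn n) : TangentSpace 𝓘(ℂ, Cn n) (e.symm z) :=
  mfderiv 𝓘(ℂ, Cn n) 𝓘(ℂ, Cn n) e.symm z v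

/-- A smooth Hermitian metric on a complex manifold: smoothly varying positive definite
Hermitian forms (linear in the first slot, conjugate-linear in the second) on the tangent spaces. -/
structure HermitianMetric (n : ℕ) (M : Type*) [TopologicalSpace M] [ChartedSpace (Cn n) M] where
  form : ∀ x : M, TangentSpace 𝓘(ℂ, Cn n) x →ₗ[ℂ] TangentSpace 𝓘(ℂ, Cn n) x →ₗ⋆[ℂ] ℂ
  conj_symm : ∀ x u v, conj (form x u v) = form x v u
  pos : ∀ x u, u ≠ 0 → 0 < (form x u u).re
  smooth : ∀ e ∈ holoCharts n M, ∀ i j : Fin n,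
    ContDiffOn ℝ ∞
      (fun z => form (e.symm z) (tangentOf e z (unitVec i)) (tangentOf e z (unitVec j))) e.target

/-- The components `g_{i \bar j}` of a Hermitian metric in the chart `e`. -/
def HermitianMetric.coord {n : ℕ} {M : Type*} [TopologicalSpace M] [ChartedSpace (Cn n) M]
    (g : HermitianMetric n M) (e : OpenPartialHomeomorph M (Cn n)) : MetricField n :=
  fun z i j => g.form (e.symm z) (tangentOf e z (unitVec i)) (tangentOf e z (unitVec j))

/-- A smooth real 1-form on a complex manifold. -/
structure RealOneForm (n : ℕ) (M : Type*) [TopologicalSpace M] [ChartedSpace (Cn n) M] where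
  form : ∀ x : M, TangentSpace 𝓘(ℂ, Cn n) x →ₗ[ℝ] ℝ
  smooth : ∀ e ∈ holoCharts n M, ∀ a : Fin n ⊕ Fin n,
    ContDiffOn ℝ ∞ (fun z => form (e.symm z) (tangentOf e z (realVec a))) e.target

/-- The real components of a 1-form in the chart `e`. -/
def RealOneForm.coord {n : ℕ} {M : Type*} [TopologicalSpace M] [ChartedSpace (Cn n) M]
    (θ : RealOneForm n M) (e : OpenPartialHomeomorph M (Cn n)) : CovectorField n :=
  fun z a => θ.form (e.symm z) (tangentOf e z (realVec a))

section Manifold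

variable {n : ℕ} {M : Type*} [TopologicalSpace M] [ChartedSpace (Cn n) M]

/-- `dω = 0`. -/
def IsKahler (g : HermitianMetric n M) : Prop :=
  ∀ e ∈ holoCharts n M, ∀ z ∈ e.target, ∀ a b c, dFundForm (g.coord e) z a b c = 0

/-- `θ` is closed and `dω = θ ∧ ω`. -/
def IsLeeForm (g : HermitianMetric n M) (θ : RealOneForm n M) : Prop :=
  ∀ e ∈ holoCharts n M, ∀ z ∈ e.target,
    (∀ a b, dCovector (θ.coord e) z a b = 0) ∧
    ∀ a b c, dFundForm (g.coord e) z a b c = wedgeFund (θ.coord e) (g.coord e) z a b c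

/-- `∇^{LC} θ = 0`. -/
def IsParallel (g : HermitianMetric n M) (θ : RealOneForm n M) : Prop :=
  ∀ e ∈ holoCharts n M, ∀ z ∈ e.target, ∀ a b, nablaCovector (g.coord e) (θ.coord e) z a b = 0

/-- A Vaisman metric: locally conformally Kähler with parallel Lee form. -/
def IsVaisman (g : HermitianMetric n M) : Prop :=
  ∃ θ : RealOneForm n M, IsLeeForm g θ ∧ IsParallel g θ

/-- `Q`-nonnegativity: `∑_{k,m} Q_{m \bar m k \bar k} (λ_k² - λ_k λ_m) ≥ 0` in every orthonormal
frame, for all real `λ`. -/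
def QNonneg (g : HermitianMetric n M) : Prop :=
  ∀ e ∈ holoCharts n M, ∀ z ∈ e.target, ∀ ε : Fin n → Cn n, IsUnitaryFrame (g.coord e) z ε →
    ∀ lam : Fin n → ℝ,
      0 ≤ ∑ k, ∑ m, (evalDiag (tensorQ (g.coord e) z) (ε m) (ε k)).re *
        (lam k ^ 2 - lam k * lam m)

/-- Nonnegative quadratic orthogonal bisectional curvature (for a Kähler metric):
`∑_{k,m} R_{m \bar m k \bar k} (λ_m - λ_k)² ≥ 0` in every orthonormal frame, for all real `λ`. -/
def NonnegQuadOrthBisectional (g : HermitianMetric n M) : Prop :=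
  ∀ e ∈ holoCharts n M, ∀ z ∈ e.target, ∀ ε : Fin n → Cn n, IsUnitaryFrame (g.coord e) z ε →
    ∀ lam : Fin n → ℝ,
      0 ≤ ∑ k, ∑ m, (evalDiag (chernCurv (g.coord e) z) (ε m) (ε k)).re *
        (lam m - lam k) ^ 2

/-- `π : N → M` is a holomorphic covering and `g'` is a Kähler metric on `N` which is conformal to
the pull-back of `g`. No condition on the group of deck transformations is imposed, so this
contains the Kähler cyclic covers. -/
structure IsKahlerCover {N : Type*} [TopologicalSpace N] [ChartedSpace (Cn n) N]
    (π : N → M) (g : HermitianMetric n M) (g' : HermitianMetric n N) : Prop where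
  covering : IsCoveringMap π
  surjective : Function.Surjective π
  holomorphic : IsLocalDiffeomorph 𝓘(ℂ, Cn n) 𝓘(ℂ, Cn n) ω π
  kahler : IsKahler g'
  conformal : ∃ f : N → ℝ, ∀ (x : N) (u v : TangentSpace 𝓘(ℂ, Cn n) x),
    g'.form x u v = (Real.exp (f x) : ℂ) *
      g.form (π x) (mfderiv 𝓘(ℂ, Cn n) 𝓘(ℂ, Cn n) π x u) (mfderiv 𝓘(ℂ, Cn n) 𝓘(ℂ, Cn n) π x v)

end Manifold

/-! ### Diagonal Hopf manifolds -/

/-- Multipliers `α₁, …, αₙ` with `0 < |α₁| = ⋯ = |αₙ| < 1`. -/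
structure HopfMultipliers (n : ℕ) where
  val : Fin n → ℂ
  ne_zero : ∀ i, val i ≠ 0
  norm_lt_one : ∀ i, ‖val i‖ < 1
  norm_eq : ∀ i j, ‖val i‖ = ‖val j‖

/-- `ℂⁿ ∖ {0}`, as an open subset of `ℂⁿ`. -/
abbrev punctured (n : ℕ) : TopologicalSpace.Opens (Cn n) := ⟨{0}ᶜ, isOpen_compl_singleton⟩

/-- `αᵏ z = (α₁ᵏ z₁, …, αₙᵏ zₙ)` for `k : ℤ`. -/
def scale {n : ℕ} (α : HopfMultipliers n) (k : ℤ) (z : Cn n) : Cn n :=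
  WithLp.toLp 2 fun i => α.val i ^ k * z i

/-- The equivalence relation generated by `z ∼ (α₁ z₁, …, αₙ zₙ)` on `ℂⁿ ∖ {0}`. -/
def hopfSetoid {n : ℕ} (α : HopfMultipliers n) : Setoid (punctured n) where
  r z w := ∃ k : ℤ, (w : Cn n) = scale α k z
  iseqv :=
    { refl := fun z => ⟨0, by ext i; simp [scale]⟩
      symm := by
        rintro z w ⟨k, hk⟩
        refine ⟨-k, ?_⟩
        rw [hk]
        ext i
        have := zpow_ne_zero k (α.ne_zero i)
        simp [scale, this]
      trans := by
        rintro x y z ⟨k, hk⟩ ⟨l, hl⟩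
        refine ⟨l + k, ?_⟩
        rw [hl, hk]
        ext i
        simp [scale, zpow_add₀ (α.ne_zero i), mul_assoc] }

/-- The diagonal Hopf manifold `(ℂⁿ ∖ {0}) / ∼`. -/
def Hopf {n : ℕ} (α : HopfMultipliers n) : Type := Quotient (hopfSetoid α)

instance {n : ℕ} (α : HopfMultipliers n) : TopologicalSpace (Hopf α) :=
  inferInstanceAs (TopologicalSpace (Quotient (hopfSetoid α)))

/-- The projection `ℂⁿ ∖ {0} → Hopf α`. -/
def hopfProj {n : ℕ} (α : HopfMultipliers n) (z : punctured n) : Hopf α :=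
  Quotient.mk (hopfSetoid α) z

section HopfCharts

variable {n : ℕ} (α : HopfMultipliers n)

theorem hopfProj_surjective : Function.Surjective (hopfProj α) := Quotient.mk_surjective

theorem hopfProj_continuous : Continuous (hopfProj α) := continuous_quotient_mk'

theorem hopfProj_eq_iff (z w : punctured n) :
    hopfProj α z = hopfProj α w ↔ ∃ k : ℤ, (w : Cn n) = scale α k z :=
  Quotient.eq (r := hopfSetoid α)

theorem scale_ne_zero (k : ℤ) {z : Cn n} (hz : z ≠ 0) : scale α k z ≠ 0 := by
  intro h
  apply hz
  ext i
  have h' := congrArg (fun v : Cn n => v i) h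
  simpa [scale, zpow_ne_zero k (α.ne_zero i)] using h'

theorem scale_contDiff (k : ℤ) : ContDiff ℂ ω (scale α k) := by
  unfold scale
  fun_prop

theorem norm_scale (i : Fin n) (k : ℤ) (z : Cn n) : ‖scale α k z‖ = ‖α.val i‖ ^ k * ‖z‖ := by
  have h : 0 ≤ ‖α.val i‖ ^ k := by positivity
  rw [← sq_eq_sq₀ (norm_nonneg _) (by positivity), mul_pow, EuclideanSpace.norm_sq_eq,
    EuclideanSpace.norm_sq_eq, Finset.mul_sum]
  refine Finset.sum_congr rfl fun j _ => ?_
  simp [scale, mul_pow, α.norm_eq j i]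

theorem hopfProj_isOpenMap : IsOpenMap (hopfProj α) := by
  intro U hU
  have hq : Topology.IsQuotientMap (hopfProj α) := isQuotientMap_quotient_mk'
  rw [← hq.isOpen_preimage]
  have : hopfProj α ⁻¹' (hopfProj α '' U) =
      ⋃ k : ℤ, (fun z : punctured n =>
        (⟨scale α k z, scale_ne_zero α k z.2⟩ : punctured n)) ⁻¹' U := by
    ext z
    simp only [Set.mem_preimage, Set.mem_image, Set.mem_iUnion]
    constructor
    · rintro ⟨w, hw, hwz⟩
      obtain ⟨k, hk⟩ := (hopfProj_eq_iff α z w).1 hwz.symm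
      refine ⟨k, ?_⟩
      have : (⟨scale α k z, scale_ne_zero α k z.2⟩ : punctured n) = w := Subtype.ext hk.symm
      rwa [this]
    · rintro ⟨k, hk⟩
      exact ⟨_, hk, ((hopfProj_eq_iff α z _).2 ⟨k, rfl⟩).symm⟩
  rw [this]
  refine isOpen_iUnion fun k => hU.preimage ?_
  exact ((scale_contDiff α k).continuous.comp continuous_subtype_val).subtype_mk _

theorem hopfProj_isLocalHomeomorph : IsLocalHomeomorph (hopfProj α) := by
  rw [isLocalHomeomorph_iff_isOpenEmbedding_restrict]
  intro z
  have hz : (z : Cn n) ≠ 0 := z.2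
  obtain ⟨i, -⟩ : ∃ i, (z : Cn n) i ≠ 0 := by
    by_contra! h
    exact hz (by ext i; simpa using h i)
  set ρ := ‖α.val i‖ with hρ
  have hρ0 : 0 < ρ := norm_pos_iff.2 (α.ne_zero i)
  have hρ1 : ρ < 1 := α.norm_lt_one i
  have hz0 : 0 < ‖(z : Cn n)‖ := norm_pos_iff.2 hz
  let A : Set (punctured n) :=
    {w | ρ * ‖(z : Cn n)‖ ^ 2 < ‖(w : Cn n)‖ ^ 2 ∧ ρ * ‖(w : Cn n)‖ ^ 2 < ‖(z : Cn n)‖ ^ 2}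
  have hA : IsOpen A := by
    have hc : Continuous fun w : punctured n => ‖(w : Cn n)‖ ^ 2 := by fun_prop
    exact (isOpen_lt continuous_const hc).inter
      (isOpen_lt (continuous_const.mul hc) continuous_const)
  refine ⟨A, hA.mem_nhds ⟨by nlinarith [pow_pos hz0 2], by nlinarith [pow_pos hz0 2]⟩, ?_⟩
  refine .of_continuous_injective_isOpenMap ((hopfProj_continuous α).comp continuous_subtype_val)
    ?_ ((hopfProj_isOpenMap α).domRestrict hA)
  -- no nontrivial power of the contraction maps a point of the annulus into the annulus
  have key : ∀ (x y : A) (k : ℤ), 0 < k → (y.1 : Cn n) ≠ scale α k x.1 := by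
    intro x y k hk h
    have h1 : ‖(y.1 : Cn n)‖ = ρ ^ k * ‖(x.1 : Cn n)‖ := by rw [h, norm_scale α i]
    have h2 : ρ ^ k ≤ ρ := by
      simpa using zpow_le_zpow_right_of_le_one₀ hρ0 hρ1.le (show (1 : ℤ) ≤ k by omega)
    have h3 : ‖(y.1 : Cn n)‖ ≤ ρ * ‖(x.1 : Cn n)‖ := by
      rw [h1]; exact mul_le_mul_of_nonneg_right h2 (norm_nonneg _)
    have h4 : ‖(y.1 : Cn n)‖ ^ 2 ≤ ρ * (ρ * ‖(x.1 : Cn n)‖ ^ 2) := by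
      calc _ ≤ (ρ * ‖(x.1 : Cn n)‖) ^ 2 := by gcongr
        _ = _ := by ring
    have h5 := x.2.2
    have h6 := y.2.1
    nlinarith
  intro x y hxy
  obtain ⟨k, hk⟩ := (hopfProj_eq_iff α x.1 y.1).1 hxy
  obtain ⟨l, hl⟩ := (hopfProj_eq_iff α y.1 x.1).1 hxy.symm
  rcases lt_trichotomy k 0 with h | h | h
  · exfalso
    refine key y x (-k) (by omega) ?_
    rw [hk]
    ext j
    simp [scale, zpow_ne_zero k (α.ne_zero j)]
  · subst h
    apply Subtype.ext
    apply Subtype.ext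
    rw [hk]
    ext j
    simp [scale]
  · exact absurd hk (key x y k h)

/-- The charts of the Hopf manifold are the local inverses of the projection. -/
instance : ChartedSpace (Cn n) (Hopf α) :=
  (hopfProj_isLocalHomeomorph α).chartedSpace (hopfProj_surjective α)

theorem hopf_chart_symm {e : OpenPartialHomeomorph (Hopf α) (Cn n)}
    (he : e ∈ atlas (Cn n) (Hopf α)) {w : Cn n} (hw : w ∈ e.target) :
    ∃ h : w ∈ punctured n, e.symm w = hopfProj α ⟨w, h⟩ := by
  obtain ⟨q, rfl⟩ := he
  generalize (hopfProj_surjective α).hasRightInverse.choose q = x at hw ⊢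
  have hw' : w ∈ (chartAt (Cn n) x).target := by
    rw [OpenPartialHomeomorph.trans_target] at hw
    exact hw.1
  have h1 : (((chartAt (Cn n) x).symm w : punctured n) : Cn n) = w :=
    (chartAt (Cn n) x).right_inv hw'
  have h : w ∈ punctured n := h1 ▸ ((chartAt (Cn n) x).symm w).2
  refine ⟨h, ?_⟩
  have h2 : (chartAt (Cn n) x).symm w = (⟨w, h⟩ : punctured n) := Subtype.ext h1
  rw [OpenPartialHomeomorph.trans_symm_eq_symm_trans_symm, OpenPartialHomeomorph.trans_apply, h2,
    IsLocalHomeomorph.localInverseAt_symm]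

instance : IsManifold 𝓘(ℂ, Cn n) ω (Hopf α) := by
  apply isManifold_of_contDiffOn
  intro e e' he he' w₀ hw₀
  have hw₀' : w₀ ∈ (e.symm ≫ₕ e').source := hw₀.1
  rw [OpenPartialHomeomorph.trans_source] at hw₀'
  obtain ⟨hs, ht⟩ := hw₀'
  have hs : w₀ ∈ e.target := hs
  have ht : e.symm w₀ ∈ e'.source := ht
  obtain ⟨h0, h1⟩ := hopf_chart_symm α he hs
  obtain ⟨h2, h3⟩ := hopf_chart_symm α he' (e'.map_source ht)
  have h3 := h1.symm.trans ((e'.left_inv ht).symm.trans h3)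
  obtain ⟨k, hk⟩ := (hopfProj_eq_iff α _ _).1 h3
  have hk : e' (e.symm w₀) = scale α k w₀ := hk
  refine ContDiffAt.contDiffWithinAt ?_
  refine (scale_contDiff α k).contDiffAt.congr_of_eventuallyEq ?_
  have hn : ∀ᶠ w in 𝓝 w₀, w ∈ e.target := e.open_target.mem_nhds hs
  have hn' : ∀ᶠ w in 𝓝 w₀, scale α k w ∈ e'.target :=
    (scale_contDiff α k).continuous.continuousAt.eventually_mem
      (e'.open_target.mem_nhds (hk ▸ e'.map_source ht))
  filter_upwards [hn, hn'] with w hw hw'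
  obtain ⟨a, ha⟩ := hopf_chart_symm α he hw
  obtain ⟨b, hb⟩ := hopf_chart_symm α he' hw'
  have hab : e.symm w = e'.symm (scale α k w) := by
    rw [ha, hb]
    exact (hopfProj_eq_iff α _ _).2 ⟨k, rfl⟩
  change e' (e.symm w) = scale α k w
  rw [hab, e'.right_inv hw']

end HopfCharts

end QPositivity

end

open QPositivity

/-!
Locally `ω̃ = e^F π^*ω`. Since `ω̃` is Kähler, `-dF` solves the equation `dω = θ ∧ ω`, which for
`n ≥ 2` has at most one solution, so that the Lee form is `θ = -dF`. Together, `∇θ = 0` and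
`dω = θ ∧ ω` express the complex Hessian of `F` through `θ` and the metric. Inserting it into the
conformal change of the Chern curvature gives, in a unitary frame and for `m ≠ k`,
`Q_{m \bar m k \bar k} = e^{-F} R̃_{m \bar m k \bar k} + |X|² - |X_k|² - |X_m|²`, where `X` is dual
to `θ` up to a constant factor. The last three terms are nonnegative by Bessel's inequality and so
are the weights `λ_k² - λ_k λ_m` after symmetrization: `R̃` is the curvature of a Kähler metric, so
`R̃_{m \bar m k \bar k}` is symmetric in `m` and `k`, and the weight becomes `½ (λ_m - λ_k)²`.

The Hopf metric is conformal to the flat metric of `ℂⁿ ∖ {0}`, with factor `4 / |z|²`, and `R̃ = 0`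
for the latter.
-/

noncomputable section

namespace QPositivity

open scoped ComplexOrder

variable {n : ℕ}

/-! ### Coordinate frames and sesquilinear forms -/

theorem unitVec_apply (i j : Fin n) : (unitVec i : Cn n) j = if j = i then 1 else 0 := by
  simp [unitVec]

theorem sum_smul_unitVec (u : Cn n) : ∑ i, u i • unitVec i = u := by
  ext j
  simp [unitVec_apply]

/-- The real coordinate frame `realVec` as a basis of `ℂⁿ` over `ℝ`. -/
def realBasis (n : ℕ) : Module.Basis (Fin n ⊕ Fin n) ℝ (Cn n) :=
  .ofEquivFun
    { toFun u := Sum.elim (fun i => (u i).re) fun i => (u i).im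
      invFun x := ∑ a, x a • realVec a
      map_add' u v := by ext (i | i) <;> simp
      map_smul' r u := by ext (i | i) <;> simp
      left_inv u := by ext j; simp [realVec, unitVec_apply, Complex.re_add_im]
      right_inv x := by ext (i | i) <;> simp [realVec, unitVec_apply, apply_ite] }

@[simp]
theorem realBasis_apply (a : Fin n ⊕ Fin n) : realBasis n a = realVec a := by
  simp [realBasis, Pi.single_apply, ite_smul, -Fintype.sum_sum_type]

/-- The sesquilinear form `(u, v) ↦ ∑ᵢⱼ Aᵢⱼ uⁱ \bar{vʲ}` of a matrix `A`, linear in `A`. -/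
def sesq : Matrix (Fin n) (Fin n) ℂ →ₗ[ℂ] Cn n →ₗ[ℂ] Cn n →ₗ⋆[ℂ] ℂ where
  toFun A := LinearMap.mk₂'ₛₗ (RingHom.id ℂ) (starRingEnd ℂ)
    (fun u v => ∑ i, ∑ j, A i j * u i * conj (v j))
    (fun u u' v => by simp [mul_add, add_mul, Finset.sum_add_distrib])
    (fun c u v => by simp [Finset.mul_sum, mul_left_comm, mul_assoc])
    (fun u v v' => by simp [mul_add, Finset.sum_add_distrib])
    (fun c u v => by simp [Finset.mul_sum, mul_left_comm])
  map_add' A B := by ext u v; simp [add_mul, Finset.sum_add_distrib]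
  map_smul' c A := by ext u v; simp [Finset.mul_sum, mul_assoc]

theorem sesq_apply (A : Matrix (Fin n) (Fin n) ℂ) (u v : Cn n) :
    sesq A u v = ∑ i, ∑ j, A i j * u i * conj (v j) := rfl

theorem sesq_unitVec (A : Matrix (Fin n) (Fin n) ℂ) (i j : Fin n) :
    sesq A (unitVec i) (unitVec j) = A i j := by
  simp [sesq_apply, unitVec_apply]

theorem herm_eq_sesq (G : MetricField n) (z u v : Cn n) : herm G z u v = sesq (G z) u v := rfl

theorem sesq_real_smul (A : Matrix (Fin n) (Fin n) ℂ) (r : ℝ) (u v : Cn n) :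
    sesq (r • A) u v = r * sesq A u v := by
  rw [← Complex.coe_smul, map_smul]; rfl

theorem sesq_real_smul_left (A : Matrix (Fin n) (Fin n) ℂ) (r : ℝ) (u v : Cn n) :
    sesq A (r • u) v = r * sesq A u v := by
  rw [← Complex.coe_smul, map_smul]; rfl

theorem sesq_real_smul_right (A : Matrix (Fin n) (Fin n) ℂ) (r : ℝ) (u v : Cn n) :
    sesq A u (r • v) = r * sesq A u v := by
  rw [← Complex.coe_smul, map_smulₛₗ]; simp

theorem sesq_I_left (A : Matrix (Fin n) (Fin n) ℂ) (u v : Cn n) :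
    sesq A (Complex.I • u) v = Complex.I * sesq A u v := by
  rw [map_smul]; rfl

theorem sesq_I_right (A : Matrix (Fin n) (Fin n) ℂ) (u v : Cn n) :
    sesq A u (Complex.I • v) = -Complex.I * sesq A u v := by
  rw [map_smulₛₗ]; simp

section IsHermitian

variable {A : Matrix (Fin n) (Fin n) ℂ}

theorem sesq_conj (hA : A.IsHermitian) (u v : Cn n) : conj (sesq A u v) = sesq A v u := by
  simp only [sesq_apply, map_sum, map_mul, starRingEnd_apply, hA.apply, star_star]
  rw [Finset.sum_comm]
  simp only [mul_right_comm]

theorem sesq_re_comm (hA : A.IsHermitian) (u v : Cn n) : (sesq A u v).re = (sesq A v u).re := by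
  rw [← sesq_conj hA, Complex.conj_re]

theorem sesq_im_comm (hA : A.IsHermitian) (u v : Cn n) : (sesq A u v).im = -(sesq A v u).im := by
  rw [← sesq_conj hA, Complex.conj_im]

theorem ofReal_sesq_self_re (hA : A.IsHermitian) (u : Cn n) :
    ((sesq A u u).re : ℂ) = sesq A u u :=
  Complex.conj_eq_iff_re.1 (sesq_conj hA u u)

theorem sesq_self_eq_dotProduct (A : Matrix (Fin n) (Fin n) ℂ) (u : Cn n) :
    sesq A u u = star (star u.ofLp) ⬝ᵥ A.mulVec (star u.ofLp) := by
  simp only [sesq_apply, dotProduct, Matrix.mulVec, Finset.mul_sum, star_star, Pi.star_apply,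
    starRingEnd_apply, mul_left_comm, mul_assoc]

theorem posDef_iff_sesq : A.PosDef ↔ A.IsHermitian ∧ ∀ u, u ≠ 0 → 0 < (sesq A u u).re := by
  rw [Matrix.posDef_iff_dotProduct_mulVec]
  refine and_congr_right fun hA => ⟨fun h u hu => ?_, fun h x hx => ?_⟩
  · have := h (x := star u.ofLp) (by simpa using hu)
    rw [← sesq_self_eq_dotProduct] at this
    exact (Complex.lt_def.1 this).1
  · have := h (WithLp.toLp 2 (star x)) (by simpa using hx)
    rw [← star_star x, ← WithLp.ofLp_toLp 2 (star x), ← sesq_self_eq_dotProduct,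
      ← ofReal_sesq_self_re hA]
    exact_mod_cast this

end IsHermitian

/-! ### Hermitian metrics to first order -/

section FDeriv

variable {E : Type*} [NormedAddCommGroup E] [NormedSpace ℝ E] {f : E → ℂ} {x : E}

theorem fderiv_conj_apply (f : E → ℂ) (x d : E) :
    fderiv ℝ (fun y => conj (f y)) x d = conj (fderiv ℝ f x d) :=
  DFunLike.congr_fun (fderiv_star (𝕜 := ℝ) (f := f) (x := x)) d

theorem fderiv_re_apply (hf : DifferentiableAt ℝ f x) (d : E) :
    fderiv ℝ (fun y => (f y).re) x d = (fderiv ℝ f x d).re :=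
  DFunLike.congr_fun (Complex.reCLM.hasFDerivAt.comp x hf.hasFDerivAt).fderiv d

theorem fderiv_im_apply (hf : DifferentiableAt ℝ f x) (d : E) :
    fderiv ℝ (fun y => (f y).im) x d = (fderiv ℝ f x d).im :=
  DFunLike.congr_fun (Complex.imCLM.hasFDerivAt.comp x hf.hasFDerivAt).fderiv d

end FDeriv

variable {G : MetricField n} {z : Cn n}

/-- The derivative of a matrix-valued function along a vector, taken entrywise. -/
def dMat (G : MetricField n) (z : Cn n) : Cn n →ₗ[ℝ] Matrix (Fin n) (Fin n) ℂ where
  toFun d := .of fun i j => fderiv ℝ (fun w => G w i j) z d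
  map_add' d d' := by ext i j; simp
  map_smul' r d := by ext i j; simp

theorem dMat_apply (G : MetricField n) (z d : Cn n) (i j : Fin n) :
    dMat G z d i j = fderiv ℝ (fun w => G w i j) z d := rfl

theorem dMat_isHermitian (hG : ∀ᶠ w in 𝓝 z, (G w).IsHermitian) (d : Cn n) :
    (dMat G z d).IsHermitian := by
  ext i j
  have : (fun w => conj (G w j i)) =ᶠ[𝓝 z] fun w => G w i j := hG.mono fun w hw => hw.apply i j
  rw [Matrix.conjTranspose_apply, dMat_apply, dMat_apply, ← starRingEnd_apply, ← fderiv_conj_apply,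
    this.fderiv_eq]

theorem hasFDerivAt_herm (hG : ∀ i j, DifferentiableAt ℝ (fun w => G w i j) z) (u v : Cn n) :
    HasFDerivAt (fun w => herm G w u v)
      (∑ i, ∑ j, (u i * conj (v j)) • fderiv ℝ (fun w => G w i j) z) z := by
  simp only [herm, mul_assoc]
  exact .fun_sum fun i _ => .fun_sum fun j _ => (hG i j).hasFDerivAt.mul_const _

theorem fderiv_herm (hG : ∀ i j, DifferentiableAt ℝ (fun w => G w i j) z) (u v d : Cn n) :
    fderiv ℝ (fun w => herm G w u v) z d = sesq (dMat G z d) u v := by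
  simp [(hasFDerivAt_herm hG u v).fderiv, sesq_apply, dMat_apply, mul_comm, mul_left_comm,
    mul_assoc]

theorem dR_fundForm (hG : ∀ i j, DifferentiableAt ℝ (fun w => G w i j) z)
    (a b c : Fin n ⊕ Fin n) :
    dR a (fun w => fundForm G w b c) z =
      -2 * (sesq (dMat G z (realVec a)) (realVec b) (realVec c)).im := by
  have hd := (hasFDerivAt_herm hG (realVec b) (realVec c)).differentiableAt
  have hd' : DifferentiableAt ℝ (fun w => (herm G w (realVec b) (realVec c)).im) z :=
    Complex.imCLM.differentiableAt.comp z hd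
  simp only [dR, fundForm]
  rw [fderiv_const_mul hd', smul_apply, fderiv_im_apply hd, fderiv_herm hG, smul_eq_mul]

theorem dR_riem (hG : ∀ i j, DifferentiableAt ℝ (fun w => G w i j) z)
    (a b c : Fin n ⊕ Fin n) :
    dR a (fun w => riem G w b c) z =
      2 * (sesq (dMat G z (realVec a)) (realVec b) (realVec c)).re := by
  have hd := (hasFDerivAt_herm hG (realVec b) (realVec c)).differentiableAt
  have hd' : DifferentiableAt ℝ (fun w => (herm G w (realVec b) (realVec c)).re) z :=
    Complex.reCLM.differentiableAt.comp z hd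
  simp only [dR, riem]
  rw [fderiv_const_mul hd', smul_apply, fderiv_re_apply hd, fderiv_herm hG, smul_eq_mul]

/-! ### The equation `dω = θ ∧ ω` at a point -/

/-- The equation `dω = l ∧ ω` at `z`, evaluated on arbitrary real tangent vectors instead of the
coordinate frame and divided by `-2`. -/
def LeeAt (G : MetricField n) (z : Cn n) (l : Cn n →ₗ[ℝ] ℝ) : Prop :=
  ∀ u v w, (sesq (dMat G z u) v w + sesq (dMat G z v) w u + sesq (dMat G z w) u v).im =
    l u * (sesq (G z) v w).im + l v * (sesq (G z) w u).im + l w * (sesq (G z) u v).im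

theorem eq_zero_of_cyclic_of_basis {ι V W : Type*} [AddCommGroup V] [Module ℝ V]
    [AddCommGroup W] [Module ℝ W] (b : Module.Basis ι ℝ V) {f : V → V → V → W}
    (hlin : ∀ v w, IsLinearMap ℝ fun u => f u v w) (hcyc : ∀ u v w, f u v w = f v w u)
    (hf : ∀ i j k, f (b i) (b j) (b k) = 0) (u v w : V) : f u v w = 0 := by
  have extend {v w : V} (h : ∀ i, f (b i) v w = 0) (u : V) : f u v w = 0 :=
    DFunLike.congr_fun (b.ext (f₁ := (hlin v w).mk' _) (f₂ := 0) h) u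
  have h₁ (u : V) (j k) : f u (b j) (b k) = 0 := extend (hf · j k) u
  have h₂ (u v : V) (k) : f u (b k) v = 0 := extend (fun i => by rw [← hcyc, h₁]) u
  exact extend (fun i => by rw [← hcyc, h₂]) u

theorem leeAt_iff (hG : ∀ i j, DifferentiableAt ℝ (fun w => G w i j) z) {θ : CovectorField n}
    {l : Cn n →ₗ[ℝ] ℝ} (hl : ∀ a, θ z a = l (realVec a)) :
    LeeAt G z l ↔ ∀ a b c, dFundForm G z a b c = wedgeFund θ G z a b c := by
  let f (u v w : Cn n) : ℝ :=
    (sesq (dMat G z u) v w + sesq (dMat G z v) w u + sesq (dMat G z w) u v).im -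
      (l u * (sesq (G z) v w).im + l v * (sesq (G z) w u).im + l w * (sesq (G z) u v).im)
  have hlin (v w : Cn n) : IsLinearMap ℝ fun u => f u v w :=
    ⟨fun u u' => by simp only [f, map_add, LinearMap.add_apply, Complex.add_im]; ring,
      fun r u => by
        simp only [f, map_smul, sesq_real_smul, sesq_real_smul_left, sesq_real_smul_right,
          Complex.add_im, Complex.im_ofReal_mul, smul_eq_mul]
        ring⟩
  have hcyc (u v w : Cn n) : f u v w = f v w u := by
    simp only [f, Complex.add_im]
    ring
  have hcoord (a b c) : dFundForm G z a b c - wedgeFund θ G z a b c =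
      -2 * f (realVec a) (realVec b) (realVec c) := by
    simp only [dFundForm, wedgeFund, dR_fundForm hG, f, Complex.add_im]
    simp only [hl, fundForm, herm_eq_sesq]
    ring
  refine ⟨fun h a b c => ?_, fun h u v w => sub_eq_zero.1 <|
    eq_zero_of_cyclic_of_basis (realBasis n) hlin hcyc (fun a b c => ?_) u v w⟩
  · rw [← sub_eq_zero, hcoord, mul_eq_zero]
    exact .inr (sub_eq_zero.2 (h _ _ _))
  · have := hcoord a b c
    rw [h, sub_self] at this
    simpa using this.symm

theorem LeeAt.torsion {l : Cn n →ₗ[ℝ] ℝ} (h : LeeAt G z l)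
    (hG : ∀ᶠ w in 𝓝 z, (G w).IsHermitian) (u v w : Cn n) :
    (sesq (dMat G z u) v w - Complex.I * sesq (dMat G z (Complex.I • u)) v w) -
      (sesq (dMat G z v) u w - Complex.I * sesq (dMat G z (Complex.I • v)) u w) =
    (l u - Complex.I * l (Complex.I • u)) * sesq (G z) v w -
      (l v - Complex.I * l (Complex.I • v)) * sesq (G z) u w := by
  have hc (d x y) : conj (sesq (dMat G z d) x y) = sesq (dMat G z d) y x :=
    sesq_conj (dMat_isHermitian hG d) x y
  have h1 := h u v w
  have h2 := h (Complex.I • u) (Complex.I • v) w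
  have h3 := h (Complex.I • u) v w
  have h4 := h u (Complex.I • v) w
  simp only [sesq_I_left, sesq_I_right] at h1 h2 h3 h4
  rw [← sesq_conj hG.self_of_nhds u w] at h1 h2 h3 h4
  rw [← hc v u w] at h1
  rw [← hc _ u w] at h2 h3 h4
  simp only [Complex.add_im, Complex.mul_im, Complex.mul_re, Complex.I_re, Complex.I_im,
    Complex.conj_re, Complex.conj_im, Complex.neg_re, Complex.neg_im] at h1 h2 h3 h4
  apply Complex.ext <;>
    simp only [Complex.sub_re, Complex.mul_re, Complex.I_re, Complex.I_im, Complex.sub_im,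
      Complex.mul_im, Complex.ofReal_re, Complex.ofReal_im]
  · linear_combination h3 + h4
  · linear_combination h1 - h2

/-! ### Parallel 1-forms -/

/-- The Riemannian metric `2 Re h` of the Hermitian form `h` of a matrix, as a real bilinear form
depending linearly on the matrix. -/
def riemForm : Matrix (Fin n) (Fin n) ℂ →ₗ[ℝ] LinearMap.BilinForm ℝ (Cn n) where
  toFun A := LinearMap.mk₂ ℝ (fun u v => 2 * (sesq A u v).re)
    (fun u u' v => by simp [mul_add]) (fun r u v => by simp [mul_left_comm])
    (fun u v v' => by simp [mul_add]) (fun r u v => by simp [sesq_real_smul_right, mul_left_comm])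
  map_add' A B := by ext u v; simp [mul_add]
  map_smul' r A := by ext u v; simp [mul_left_comm]

theorem riemForm_apply (A : Matrix (Fin n) (Fin n) ℂ) (u v : Cn n) :
    riemForm A u v = 2 * (sesq A u v).re := rfl

theorem riemForm_comm {A : Matrix (Fin n) (Fin n) ℂ} (hA : A.IsHermitian) (u v : Cn n) :
    riemForm A u v = riemForm A v u := by
  rw [riemForm_apply, riemForm_apply, sesq_re_comm hA]

theorem riemForm_nondegenerate {A : Matrix (Fin n) (Fin n) ℂ} (hA : A.PosDef) :
    (riemForm A).Nondegenerate := by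
  have hsymm : LinearMap.IsSymm (riemForm A) := ⟨riemForm_comm hA.isHermitian⟩
  refine hsymm.isRefl.nondegenerate_iff_separatingLeft.2 fun u hu => ?_
  by_contra hne
  exact ((posDef_iff_sesq.1 hA).2 u hne).ne' (by simpa [riemForm_apply] using hu u)

theorem exists_riemForm_eq {A : Matrix (Fin n) (Fin n) ℂ} (hA : A.PosDef) (l : Cn n →ₗ[ℝ] ℝ) :
    ∃ X, riemForm A X = l :=
  ⟨((riemForm A).toDual (riemForm_nondegenerate hA)).symm l,
    LinearMap.ext (LinearMap.BilinForm.apply_toDual_symm_apply l)⟩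

theorem riem_eq_toMatrix (G : MetricField n) (z : Cn n) :
    riem G z = LinearMap.BilinForm.toMatrix (realBasis n) (riemForm (G z)) := by
  ext a b
  simp [riem, riemForm_apply, herm_eq_sesq, LinearMap.BilinForm.toMatrix_apply]

/-- The right-hand side of the Koszul formula for `g(∇ᵤ v, w)`, where `g = 2 Re h` and `u`, `v`,
`w` are extended to constant vector fields. -/
def koszul (G : MetricField n) (z : Cn n) : Cn n →ₗ[ℝ] Cn n →ₗ[ℝ] Cn n →ₗ[ℝ] ℝ :=
  let T : Cn n →ₗ[ℝ] Cn n →ₗ[ℝ] Cn n →ₗ[ℝ] ℝ := riemForm ∘ₗ dMat G z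
  LinearMap.mk₂ ℝ (fun u v => (1 / 2 : ℝ) • (T u v + T v u - (T.flip u).flip v))
    (fun u u' v => by ext w; simp; ring) (fun r u v => by ext w; simp; ring)
    (fun u v v' => by ext w; simp; ring) (fun r u v => by ext w; simp; ring)

theorem koszul_apply (G : MetricField n) (z u v w : Cn n) :
    koszul G z u v w =
      (sesq (dMat G z u) v w + sesq (dMat G z v) u w - sesq (dMat G z w) u v).re := by
  simp only [koszul, LinearMap.mk₂_apply, LinearMap.smul_apply, LinearMap.sub_apply,
    LinearMap.add_apply, LinearMap.flip_apply, LinearMap.comp_apply, riemForm_apply, smul_eq_mul,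
    Complex.sub_re, Complex.add_re]
  ring

theorem riemForm_sum_christoffel (hG : ∀ i j, DifferentiableAt ℝ (fun w => G w i j) z)
    (hpos : (G z).PosDef) (a b : Fin n ⊕ Fin n) (X : Cn n) :
    riemForm (G z) X (∑ c, christoffel G z a b c • realVec c) =
      koszul G z (realVec a) (realVec b) X := by
  have hdet : IsUnit (riem G z).det := by
    rw [isUnit_iff_ne_zero, riem_eq_toMatrix,
      ← LinearMap.BilinForm.nondegenerate_iff_det_ne_zero]
    exact riemForm_nondegenerate hpos
  let K (d : Fin n ⊕ Fin n) : ℝ := koszul G z (realVec a) (realVec b) (realVec d)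
  have hΓ : christoffel G z a b = (riem G z)⁻¹.mulVec K := by
    ext c
    simp only [christoffel, Matrix.mulVec, dotProduct, K, koszul_apply, dR_riem hG,
      Complex.add_re, Complex.sub_re, Finset.mul_sum]
    exact Finset.sum_congr rfl fun d _ => by ring
  suffices h : (riemForm (G z)).flip (∑ c, christoffel G z a b c • realVec c) =
      koszul G z (realVec a) (realVec b) from DFunLike.congr_fun h X
  refine (realBasis n).ext fun d => ?_
  calc (riemForm (G z)).flip (∑ c, christoffel G z a b c • realVec c) (realBasis n d)
      = (riem G z).mulVec (christoffel G z a b) d := by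
        simp [Matrix.mulVec, dotProduct, riem_eq_toMatrix, LinearMap.BilinForm.toMatrix_apply,
          mul_comm]
    _ = K d := by
        rw [hΓ, Matrix.mulVec_mulVec, Matrix.mul_nonsing_inv _ hdet, Matrix.one_mulVec]
    _ = _ := by rw [realBasis_apply]

/-- The equation `∇dF = 0` at `z`, evaluated on arbitrary vectors, where `X` stands for the vector
dual to `-dF`. -/
def ParallelAt (G : MetricField n) (F : Cn n → ℝ) (z X : Cn n) : Prop :=
  ∀ u v, fderiv ℝ (fderiv ℝ F) z u v = -koszul G z u v X

section Potential

variable {F : Cn n → ℝ} {θ : CovectorField n}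

theorem dR_neg_fderiv (hF : DifferentiableAt ℝ (fderiv ℝ F) z)
    (hθ : ∀ᶠ w in 𝓝 z, ∀ a, θ w a = -fderiv ℝ F w (realVec a)) (a b : Fin n ⊕ Fin n) :
    dR a (fun w => θ w b) z = -fderiv ℝ (fderiv ℝ F) z (realVec a) (realVec b) := by
  have h := ((ContinuousLinearMap.apply ℝ ℝ (realVec b)).hasFDerivAt.comp z hF.hasFDerivAt).neg
  have hθb : (fun w => θ w b) =ᶠ[𝓝 z]
      -(ContinuousLinearMap.apply ℝ ℝ (realVec b) ∘ fderiv ℝ F) := hθ.mono fun w hw => hw b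
  rw [dR, hθb.fderiv_eq, h.fderiv]
  rfl

theorem parallelAt_iff (hG : ∀ i j, DifferentiableAt ℝ (fun w => G w i j) z)
    (hpos : (G z).PosDef) (hF : DifferentiableAt ℝ (fderiv ℝ F) z)
    (hθ : ∀ᶠ w in 𝓝 z, ∀ a, θ w a = -fderiv ℝ F w (realVec a)) {X : Cn n}
    (hX : riemForm (G z) X = -(fderiv ℝ F z : Cn n →ₗ[ℝ] ℝ)) :
    ParallelAt G F z X ↔ ∀ a b, nablaCovector G θ z a b = 0 := by
  have hnabla (a b : Fin n ⊕ Fin n) : nablaCovector G θ z a b =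
      -(fderiv ℝ (fderiv ℝ F) z (realVec a) (realVec b) +
        koszul G z (realVec a) (realVec b) X) := by
    have hθz (c) : θ z c = riemForm (G z) X (realVec c) := by rw [hX, hθ.self_of_nhds c]; rfl
    rw [nablaCovector, dR_neg_fderiv hF hθ, ← riemForm_sum_christoffel hG hpos]
    simp only [hθz, map_sum, map_smul, smul_eq_mul]
    ring
  simp only [hnabla, neg_eq_zero, add_eq_zero_iff_eq_neg]
  refine ⟨fun h a b => h _ _, fun h u v => ?_⟩
  have hB : (fderiv ℝ (fderiv ℝ F) z).toLinearMap₁₂ =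
      -(koszul G z).compr₂ (LinearMap.applyₗ X) :=
    LinearMap.ext_basis (realBasis n) (realBasis n) fun a b => by simpa using h a b
  exact LinearMap.congr_fun₂ hB u v

theorem complexHessian_of_parallel (hG : ∀ᶠ w in 𝓝 z, (G w).IsHermitian) {X : Cn n}
    (hL : LeeAt G z (riemForm (G z) X)) (hP : ParallelAt G F z X) (u : Cn n) :
    fderiv ℝ (fderiv ℝ F) z u u + fderiv ℝ (fderiv ℝ F) z (Complex.I • u) (Complex.I • u) =
      4 * ((sesq (G z) X X).re * (sesq (G z) u u).re - Complex.normSq (sesq (G z) u X)) := by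
  have hc := hG.self_of_nhds
  have h1 := hL u (Complex.I • u) X
  rw [riemForm_comm hc X u, riemForm_comm hc X (Complex.I • u)] at h1
  rw [hP, hP]
  simp only [riemForm_apply, koszul_apply, sesq_I_left, sesq_I_right] at h1 ⊢
  rw [← sesq_conj (dMat_isHermitian hG _) u X, sesq_im_comm hc X u] at h1
  simp only [Complex.add_im, Complex.sub_re, Complex.add_re, Complex.mul_im, Complex.mul_re,
    Complex.I_re, Complex.I_im, Complex.conj_im, Complex.neg_re, Complex.neg_im,
    Complex.normSq_apply] at h1 ⊢
  linear_combination -2 * h1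

end Potential

/-! ### Wirtinger derivatives -/

section SecondDerivative

variable {E F F' : Type*} [NormedAddCommGroup E] [NormedSpace ℝ E] [NormedAddCommGroup F]
  [NormedSpace ℝ F] [NormedAddCommGroup F'] [NormedSpace ℝ F'] {f : E → F} {x : E}

theorem differentiableAt_fderiv (hf : ContDiffAt ℝ 2 f x) :
    DifferentiableAt ℝ (fderiv ℝ f) x :=
  (hf.fderiv_right (m := 1) (by norm_num)).differentiableAt (by norm_num)

theorem fderiv_fderiv_comm (hf : ContDiffAt ℝ 2 f x) (u v : E) :
    fderiv ℝ (fderiv ℝ f) x u v = fderiv ℝ (fderiv ℝ f) x v u :=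
  hf.isSymmSndFDerivAt (by simp) u v

theorem hasFDerivAt_fderiv_apply (hf : ContDiffAt ℝ 2 f x) (v : E) :
    HasFDerivAt (fun y => fderiv ℝ f y v)
      ((ContinuousLinearMap.apply ℝ F v).comp (fderiv ℝ (fderiv ℝ f) x)) x :=
  (ContinuousLinearMap.apply ℝ F v).hasFDerivAt.comp x (differentiableAt_fderiv hf).hasFDerivAt

theorem fderiv_fderiv_comp_clm (L : F →L[ℝ] F') (hf : ContDiffAt ℝ 2 f x) (u v : E) :
    fderiv ℝ (fderiv ℝ fun y => L (f y)) x u v = L (fderiv ℝ (fderiv ℝ f) x u v) := by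
  have h : fderiv ℝ (fun y => L (f y)) =ᶠ[𝓝 x] fun y => L.comp (fderiv ℝ f y) := by
    filter_upwards [hf.eventually (by simp)] with y hy
    exact (L.hasFDerivAt.comp y (hy.differentiableAt (by norm_num)).hasFDerivAt).fderiv
  have hL := (ContinuousLinearMap.compL ℝ E F F' L).hasFDerivAt.comp x
    (differentiableAt_fderiv hf).hasFDerivAt
  rw [h.fderiv_eq]
  exact congrArg (fun B : E →L[ℝ] E →L[ℝ] F' => B u v) hL.fderiv

end SecondDerivative

section Wirtinger

variable {f g : Cn n → ℂ}

theorem dZ_congr (i : Fin n) (h : f =ᶠ[𝓝 z] g) : dZ i f z = dZ i g z := by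
  simp only [dZ, h.fderiv_eq]

theorem dZbar_congr (i : Fin n) (h : f =ᶠ[𝓝 z] g) : dZbar i f z = dZbar i g z := by
  simp only [dZbar, h.fderiv_eq]

theorem dZbar_conj (i : Fin n) (f : Cn n → ℂ) (z : Cn n) :
    dZbar i (fun w => conj (f w)) z = conj (dZ i f z) := by
  simp only [dZ, dZbar, fderiv_conj_apply, map_mul, map_sub, Complex.conj_I, map_div₀, map_one,
    Complex.conj_ofNat]
  ring

theorem dZ_mul (i : Fin n) (hf : DifferentiableAt ℝ f z) (hg : DifferentiableAt ℝ g z) :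
    dZ i (fun w => f w * g w) z = dZ i f z * g z + f z * dZ i g z := by
  simp only [dZ, fderiv_fun_mul hf hg, add_apply, smul_apply, smul_eq_mul]
  ring

theorem dZ_cexp (i : Fin n) (hf : DifferentiableAt ℝ f z) :
    dZ i (fun w => Complex.exp (f w)) z = Complex.exp (f z) * dZ i f z := by
  simp only [dZ, hf.hasFDerivAt.cexp.fderiv, smul_apply, smul_eq_mul]
  ring

theorem dZbar_add (i : Fin n) (hf : DifferentiableAt ℝ f z) (hg : DifferentiableAt ℝ g z) :
    dZbar i (fun w => f w + g w) z = dZbar i f z + dZbar i g z := by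
  simp only [dZbar, fderiv_fun_add hf hg, add_apply]
  ring

theorem dZbar_mul (i : Fin n) (hf : DifferentiableAt ℝ f z) (hg : DifferentiableAt ℝ g z) :
    dZbar i (fun w => f w * g w) z = dZbar i f z * g z + f z * dZbar i g z := by
  simp only [dZbar, fderiv_fun_mul hf hg, add_apply, smul_apply, smul_eq_mul]
  ring

theorem dZbar_mul_const (i : Fin n) (hf : DifferentiableAt ℝ f z) (c : ℂ) :
    dZbar i (fun w => f w * c) z = dZbar i f z * c := by
  simp only [dZbar, fderiv_mul_const hf, smul_apply, smul_eq_mul]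
  ring

theorem dZbar_sum {ι : Type*} (s : Finset ι) (i : Fin n) {f : ι → Cn n → ℂ}
    (hf : ∀ a ∈ s, DifferentiableAt ℝ (f a) z) :
    dZbar i (fun w => ∑ a ∈ s, f a w) z = ∑ a ∈ s, dZbar i (f a) z := by
  simp only [dZbar, fderiv_fun_sum hf, sum_apply, Finset.mul_sum, ← Finset.sum_add_distrib]

theorem dZ_eq_dMat (G : MetricField n) (z : Cn n) (k i j : Fin n) :
    dZ k (fun w => G w i j) z = (1 / 2) * (sesq (dMat G z (unitVec k)) (unitVec i) (unitVec j) -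
      Complex.I * sesq (dMat G z (Complex.I • unitVec k)) (unitVec i) (unitVec j)) := by
  rw [sesq_unitVec, sesq_unitVec]
  rfl

theorem differentiableAt_dZ (i : Fin n) (hf : ContDiffAt ℝ 2 f z) :
    DifferentiableAt ℝ (dZ i f) z :=
  ((hasFDerivAt_fderiv_apply hf _).differentiableAt.sub
    ((hasFDerivAt_fderiv_apply hf _).differentiableAt.const_mul _)).const_mul _

theorem fderiv_dZ (i : Fin n) (hf : ContDiffAt ℝ 2 f z) (d : Cn n) :
    fderiv ℝ (dZ i f) z d = (1 / 2) * (fderiv ℝ (fderiv ℝ f) z d (unitVec i) -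
      Complex.I * fderiv ℝ (fderiv ℝ f) z d (Complex.I • unitVec i)) := by
  have h := ((hasFDerivAt_fderiv_apply hf (unitVec i)).sub
    ((hasFDerivAt_fderiv_apply hf (Complex.I • unitVec i)).const_mul Complex.I)).const_mul
      (1 / 2 : ℂ)
  rw [show fderiv ℝ (dZ i f) z = _ from h.fderiv]
  simp

end Wirtinger

section Levi

theorem complex_smul_eq_real_smul (c : ℂ) (u : Cn n) :
    c • u = c.re • u + c.im • (Complex.I • u) := by
  rw [← Complex.coe_smul, ← Complex.coe_smul, smul_smul, ← add_smul, Complex.re_add_im]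

theorem I_smul_complex_smul_eq_real_smul (c : ℂ) (u : Cn n) :
    Complex.I • c • u = c.re • (Complex.I • u) - c.im • u := by
  rw [smul_comm, complex_smul_eq_real_smul, smul_smul Complex.I, Complex.I_mul_I, neg_one_smul,
    smul_neg, sub_eq_add_neg]

/-- The `(1,1)`-part of a real bilinear map, as a sesquilinear form: if `B` is the real Hessian of
`f`, then `levi B` has the components `∂_{\bar j} ∂_i f`. -/
def levi (B : Cn n →L[ℝ] Cn n →L[ℝ] ℂ) : Cn n →ₗ[ℂ] Cn n →ₗ⋆[ℂ] ℂ :=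
  LinearMap.mk₂'ₛₗ (RingHom.id ℂ) (starRingEnd ℂ)
    (fun u v => (1 / 4) * (B v u - Complex.I * B v (Complex.I • u) +
      Complex.I * B (Complex.I • v) u + B (Complex.I • v) (Complex.I • u)))
    (fun u u' v => by simp only [smul_add, map_add]; ring)
    (fun c u v => by
      rw [I_smul_complex_smul_eq_real_smul, complex_smul_eq_real_smul]
      simp only [map_add, map_sub, map_smul, Complex.real_smul, RingHom.id_apply, smul_eq_mul]
      conv_rhs => rw [← Complex.re_add_im c]
      linear_combination ((c.im : ℂ) / 4 * (B v (Complex.I • u) - B (Complex.I • v) u)) *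
        Complex.I_sq)
    (fun u v v' => by simp only [smul_add, map_add, add_apply]; ring)
    (fun c u v => by
      have hc : conj c = c.re - c.im * Complex.I := by
        apply Complex.ext <;> simp
      rw [I_smul_complex_smul_eq_real_smul, complex_smul_eq_real_smul, hc]
      simp only [map_add, map_sub, map_smul, Complex.real_smul, smul_eq_mul, add_apply,
        sub_apply, smul_apply]
      linear_combination ((c.im : ℂ) / 4 * (B (Complex.I • v) u - B v (Complex.I • u))) *
        Complex.I_sq)

theorem levi_apply (B : Cn n →L[ℝ] Cn n →L[ℝ] ℂ) (u v : Cn n) :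
    levi B u v = (1 / 4) * (B v u - Complex.I * B v (Complex.I • u) +
      Complex.I * B (Complex.I • v) u + B (Complex.I • v) (Complex.I • u)) := rfl

theorem dZbar_dZ (i j : Fin n) {f : Cn n → ℂ} (hf : ContDiffAt ℝ 2 f z) :
    dZbar j (dZ i f) z = levi (fderiv ℝ (fderiv ℝ f) z) (unitVec i) (unitVec j) := by
  rw [dZbar, fderiv_dZ i hf, fderiv_dZ i hf, levi_apply]
  linear_combination (-1 / 4 * fderiv ℝ (fderiv ℝ f) z (Complex.I • unitVec j)
    (Complex.I • unitVec i)) * Complex.I_sq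

theorem levi_conj {f : Cn n → ℂ} (hf : ContDiffAt ℝ 2 f z) (u v : Cn n) :
    conj (levi (fderiv ℝ (fderiv ℝ f) z) u v) =
      levi (fderiv ℝ (fderiv ℝ fun w => conj (f w)) z) v u := by
  have h (u v : Cn n) : fderiv ℝ (fderiv ℝ fun w => conj (f w)) z u v =
      conj (fderiv ℝ (fderiv ℝ f) z v u) :=
    (fderiv_fderiv_comp_clm (Complex.conjCLE : ℂ →L[ℝ] ℂ) hf u v).trans
      (congrArg conj (fderiv_fderiv_comm hf u v))
  simp only [levi_apply, h, map_mul, map_add, map_sub, Complex.conj_I, map_div₀, map_one,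
    Complex.conj_ofNat]
  ring

theorem levi_ofReal_self {F : Cn n → ℝ} (hF : ContDiffAt ℝ 2 F z) (u : Cn n) :
    levi (fderiv ℝ (fderiv ℝ fun w => (F w : ℂ)) z) u u =
      ((1 / 4 * (fderiv ℝ (fderiv ℝ F) z u u +
        fderiv ℝ (fderiv ℝ F) z (Complex.I • u) (Complex.I • u)) : ℝ) : ℂ) := by
  have h (u v : Cn n) : fderiv ℝ (fderiv ℝ fun w => (F w : ℂ)) z u v =
      (fderiv ℝ (fderiv ℝ F) z u v : ℂ) := fderiv_fderiv_comp_clm Complex.ofRealCLM hF u v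
  simp only [levi_apply, h, fderiv_fderiv_comm hF (Complex.I • u) u]
  push_cast
  ring

end Levi

/-! ### The Chern connection and its curvature -/

/-- `G` is a Hermitian metric near `z`, of class `C²` at `z`. -/
structure HermitianAt (G : MetricField n) (z : Cn n) : Prop where
  contDiff : ∀ i j, ContDiffAt ℝ 2 (fun w => G w i j) z
  eventually_posDef : ∀ᶠ w in 𝓝 z, (G w).PosDef

namespace HermitianAt

theorem eventually (h : HermitianAt G z) : ∀ᶠ w in 𝓝 z, HermitianAt G w := by
  have hC : ∀ᶠ w in 𝓝 z, ∀ i j, ContDiffAt ℝ 2 (fun w => G w i j) w :=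
    Filter.eventually_all.2 fun i => Filter.eventually_all.2 fun j =>
      (h.contDiff i j).eventually (by simp)
  filter_upwards [hC, h.eventually_posDef.eventually_nhds] with w hCw hw using ⟨hCw, hw⟩

theorem posDef (h : HermitianAt G z) : (G z).PosDef := h.eventually_posDef.self_of_nhds

theorem isUnit (h : HermitianAt G z) : IsUnit (G z) := h.posDef.isUnit

theorem eventually_isHermitian (h : HermitianAt G z) : ∀ᶠ w in 𝓝 z, (G w).IsHermitian :=
  h.eventually_posDef.mono fun _ hw => hw.isHermitian

theorem differentiableAt (h : HermitianAt G z) (i j : Fin n) :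
    DifferentiableAt ℝ (fun w => G w i j) z :=
  (h.contDiff i j).differentiableAt (by norm_num)

end HermitianAt

theorem vecMul_chernGamma (h : IsUnit (G z)) (k i : Fin n) :
    Matrix.vecMul (chernGamma G z k i) (G z) = fun l => dZ k (fun w => G w i l) z := by
  have hΓ : chernGamma G z k i = Matrix.vecMul (fun l => dZ k (fun w => G w i l) z) (G z)⁻¹ := by
    ext m
    simp only [chernGamma, invMetric, Matrix.vecMul, dotProduct, mul_comm]
  rw [hΓ, Matrix.vecMul_vecMul, Matrix.nonsing_inv_mul _ ((Matrix.isUnit_iff_isUnit_det _).1 h),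
    Matrix.vecMul_one]

theorem sum_chernGamma_mul (h : IsUnit (G z)) (k i l : Fin n) :
    ∑ m, chernGamma G z k i m * G z m l = dZ k (fun w => G w i l) z :=
  congrFun (vecMul_chernGamma h k i) l

theorem differentiableAt_det (hG : ∀ i j, DifferentiableAt ℝ (fun w => G w i j) z) :
    DifferentiableAt ℝ (fun w => (G w).det) z := by
  simp only [Matrix.det_apply']
  fun_prop

theorem differentiableAt_invMetric (hG : ∀ i j, DifferentiableAt ℝ (fun w => G w i j) z)
    (h : IsUnit (G z)) (i j : Fin n) : DifferentiableAt ℝ (fun w => invMetric G w i j) z := by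
  simp only [invMetric, Matrix.inv_def, Matrix.smul_apply, Ring.inverse_eq_inv', smul_eq_mul,
    Matrix.adjugate_apply]
  refine ((differentiableAt_det hG).inv ((Matrix.isUnit_iff_isUnit_det _).1 h).ne_zero).mul
    (differentiableAt_det fun a b => ?_)
  obtain rfl | ha := eq_or_ne a i
  · simp
  · simpa [Matrix.updateRow_ne ha] using hG a b

namespace HermitianAt

theorem differentiableAt_chernGamma (h : HermitianAt G z) (k i j : Fin n) :
    DifferentiableAt ℝ (fun w => chernGamma G w k i j) z :=
  .fun_sum fun m _ => (differentiableAt_invMetric h.differentiableAt h.isUnit j m).mul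
    (differentiableAt_dZ k (h.contDiff i m))

theorem dZbar_eq_sum (h : HermitianAt G z) (j m l : Fin n) :
    dZbar j (fun w => G w m l) z = ∑ p, conj (chernGamma G z j l p) * G z m p := by
  rw [dZbar_congr j (h.eventually_isHermitian.mono fun w hw => (hw.apply m l).symm)]
  refine (dZbar_conj j _ z).trans ?_
  rw [← sum_chernGamma_mul h.isUnit, map_sum]
  simp only [map_mul, starRingEnd_apply, h.posDef.isHermitian.apply]

theorem chernCurv_eq (h : HermitianAt G z) (i j k l : Fin n) :
    chernCurv G z i j k l =
      sesq (G z) (.toLp 2 (chernGamma G z i k)) (.toLp 2 (chernGamma G z j l)) -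
        levi (fderiv ℝ (fderiv ℝ fun w => G w k l) z) (unitVec i) (unitVec j) := by
  have hE : (fun w => ∑ m, chernGamma G w i k m * G w m l) =ᶠ[𝓝 z] dZ i fun w => G w k l :=
    h.eventually.mono fun w hw => sum_chernGamma_mul hw.isUnit i k l
  rw [← dZbar_dZ i j (h.contDiff k l), ← dZbar_congr j hE,
    dZbar_sum _ _ fun m _ => (h.differentiableAt_chernGamma i k m).fun_mul (h.differentiableAt m l)]
  simp only [dZbar_mul j (h.differentiableAt_chernGamma i k _) (h.differentiableAt _ l),
    Finset.sum_add_distrib, h.dZbar_eq_sum, Finset.mul_sum, sesq_apply, chernCurv, neg_mul,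
    Finset.sum_neg_distrib]
  simp only [mul_comm, mul_left_comm, mul_assoc]
  ring

theorem conj_chernCurv (h : HermitianAt G z) (i j k l : Fin n) :
    conj (chernCurv G z i j k l) = chernCurv G z j i l k := by
  have hlk : (fun w => conj (G w k l)) =ᶠ[𝓝 z] fun w => G w l k :=
    h.eventually_isHermitian.mono fun w hw => hw.apply l k
  rw [h.chernCurv_eq, h.chernCurv_eq, map_sub, sesq_conj h.posDef.isHermitian,
    levi_conj (h.contDiff k l), hlk.fderiv.fderiv_eq]

theorem chernCurv_symm (h : HermitianAt G z) (hK : ∀ᶠ w in 𝓝 z, LeeAt G w 0)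
    (i j k l : Fin n) : chernCurv G z i j k l = chernCurv G z k l i j := by
  have hΓ (i k m) : (fun w => chernGamma G w i k m) =ᶠ[𝓝 z] fun w => chernGamma G w k i m := by
    filter_upwards [h.eventually, hK] with w hw hKw
    suffices Matrix.vecMul (chernGamma G w i k) (G w) = Matrix.vecMul (chernGamma G w k i) (G w)
      from congrFun (Matrix.vecMul_injective_of_isUnit hw.isUnit this) m
    rw [vecMul_chernGamma hw.isUnit, vecMul_chernGamma hw.isUnit]
    ext l
    have := hKw.torsion hw.eventually_isHermitian (unitVec i) (unitVec k) (unitVec l)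
    simp only [LinearMap.zero_apply, Complex.ofReal_zero, mul_zero, sub_zero, zero_mul] at this
    rw [dZ_eq_dMat, dZ_eq_dMat, sub_eq_zero.1 this]
  have hswap (i j k l) : chernCurv G z i j k l = chernCurv G z k j i l := by
    simp only [chernCurv, dZbar_congr j (hΓ i k _)]
  rw [hswap, ← h.conj_chernCurv, hswap, h.conj_chernCurv]

end HermitianAt

/-! ### Conformal changes -/

section Conformal

variable {G' : MetricField n} {F : Cn n → ℝ}

theorem dMat_conformal (hG : ∀ i j, DifferentiableAt ℝ (fun w => G w i j) z)
    (hF : DifferentiableAt ℝ F z) (hGG : G' =ᶠ[𝓝 z] fun w => Real.exp (F w) • G w) (u : Cn n) :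
    dMat G' z u = Real.exp (F z) • (fderiv ℝ F z u • G z + dMat G z u) := by
  ext i j
  have hij : (fun w => G' w i j) =ᶠ[𝓝 z] fun w => Real.exp (F w) • G w i j :=
    hGG.mono fun w hw => congrFun₂ hw i j
  rw [dMat_apply, hij.fderiv_eq, (hF.hasFDerivAt.exp.fun_smul (hG i j).hasFDerivAt).fderiv]
  simp [dMat_apply]
  ring

theorem LeeAt.of_conformal {l : Cn n →ₗ[ℝ] ℝ} (h : LeeAt G' z l)
    (hG : ∀ i j, DifferentiableAt ℝ (fun w => G w i j) z) (hF : DifferentiableAt ℝ F z)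
    (hGG : G' =ᶠ[𝓝 z] fun w => Real.exp (F w) • G w) :
    LeeAt G z (l - (fderiv ℝ F z : Cn n →ₗ[ℝ] ℝ)) := by
  intro u v w
  have huvw := h u v w
  simp only [dMat_conformal hG hF hGG, hGG.eq_of_nhds, map_add, LinearMap.add_apply,
    sesq_real_smul, Complex.add_im, Complex.im_ofReal_mul] at huvw
  refine mul_left_cancel₀ (Real.exp_pos (F z)).ne' ?_
  simp only [Complex.add_im, LinearMap.sub_apply, ContinuousLinearMap.coe_coe]
  linear_combination huvw

theorem koszul_conformal (hG : ∀ i j, DifferentiableAt ℝ (fun w => G w i j) z)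
    (hF : DifferentiableAt ℝ F z) (hGG : G' =ᶠ[𝓝 z] fun w => Real.exp (F w) • G w) (u v w : Cn n) :
    koszul G' z u v w = Real.exp (F z) * (koszul G z u v w +
      (fderiv ℝ F z u * (sesq (G z) v w).re + fderiv ℝ F z v * (sesq (G z) u w).re -
        fderiv ℝ F z w * (sesq (G z) u v).re)) := by
  simp only [koszul_apply, dMat_conformal hG hF hGG, map_add, LinearMap.add_apply, sesq_real_smul,
    Complex.add_re, Complex.sub_re, Complex.re_ofReal_mul]
  ring

theorem chernGamma_conformal (hG : ∀ i j, DifferentiableAt ℝ (fun w => G w i j) z)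
    (hF : DifferentiableAt ℝ F z) (h : IsUnit (G z))
    (hGG : G' =ᶠ[𝓝 z] fun w => Real.exp (F w) • G w) (i k : Fin n) :
    chernGamma G' z i k =
      chernGamma G z i k + Pi.single k (dZ i (fun w => (F w : ℂ)) z) := by
  have hGz : G' z = Complex.exp (F z) • G z := by
    rw [hGG.eq_of_nhds, ← Complex.ofReal_exp, Complex.coe_smul]
  have h' : IsUnit (G' z) := hGz ▸ h.smul (Units.mk0 _ (Complex.exp_ne_zero (F z)))
  have hFC : DifferentiableAt ℝ (fun w => (F w : ℂ)) z :=
    Complex.ofRealCLM.differentiableAt.comp z hF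
  apply Matrix.vecMul_injective_of_isUnit h'
  beta_reduce
  rw [vecMul_chernGamma h', hGz, Matrix.vecMul_smul, Matrix.add_vecMul, vecMul_chernGamma h,
    Matrix.single_vecMul]
  ext l
  have hkl : (fun w => G' w k l) =ᶠ[𝓝 z] fun w => Complex.exp (F w) * G w k l :=
    hGG.mono fun w hw => by simp [hw]
  rw [dZ_congr i hkl, dZ_mul i hFC.cexp (hG k l), dZ_cexp i hFC]
  simp only [Pi.smul_apply, Pi.add_apply, smul_eq_mul, Matrix.row_apply]
  ring

theorem chernCurv_conformal (h : HermitianAt G z) (hF : ContDiffAt ℝ 2 F z)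
    (hGG : G' =ᶠ[𝓝 z] fun w => Real.exp (F w) • G w) (i j k l : Fin n) :
    chernCurv G' z i j k l = Real.exp (F z) * (chernCurv G z i j k l -
      levi (fderiv ℝ (fderiv ℝ fun w => (F w : ℂ)) z) (unitVec i) (unitVec j) * G z k l) := by
  have hFC : ContDiffAt ℝ 2 (fun w => (F w : ℂ)) z :=
    Complex.ofRealCLM.contDiff.contDiffAt.comp z hF
  have hΓ (m) : (fun w => chernGamma G' w i k m) =ᶠ[𝓝 z] fun w => chernGamma G w i k m +
      dZ i (fun w => (F w : ℂ)) w * (Pi.single k 1 : Fin n → ℂ) m := by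
    filter_upwards [h.eventually, hF.eventually (by simp), hGG.eventually_nhds] with w hw hFw hGw
    rw [chernGamma_conformal hw.differentiableAt (hFw.differentiableAt (by norm_num)) hw.isUnit hGw]
    simp [Pi.single_apply]
  have hdΓ (m) : dZbar j (fun w => chernGamma G' w i k m) z =
      dZbar j (fun w => chernGamma G w i k m) z +
        levi (fderiv ℝ (fderiv ℝ fun w => (F w : ℂ)) z) (unitVec i) (unitVec j) *
          (Pi.single k 1 : Fin n → ℂ) m := by
    rw [dZbar_congr j (hΓ m), dZbar_add j (h.differentiableAt_chernGamma i k m)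
      ((differentiableAt_dZ i hFC).mul_const _), dZbar_mul_const j (differentiableAt_dZ i hFC)]
    exact congrArg₂ _ rfl (congrArg (· * _) (dZbar_dZ i j hFC))
  have hsum : G z k l = ∑ m, (Pi.single k 1 : Fin n → ℂ) m * G z m l := by
    simp [Pi.single_apply]
  simp only [chernCurv, hdΓ, hGG.eq_of_nhds, Matrix.smul_apply, Complex.real_smul]
  rw [hsum, Finset.mul_sum, ← Finset.sum_sub_distrib, Finset.mul_sum]
  exact Finset.sum_congr rfl fun m _ => by ring

end Conformal

/-- `evalDiag`, as a linear function of the tensor. -/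
def evalDiagLinear (u v : Cn n) : (Fin n → Fin n → Fin n → Fin n → ℂ) →ₗ[ℂ] ℂ where
  toFun A := evalDiag A u v
  map_add' A B := by simp only [evalDiag, Pi.add_apply, add_mul, Finset.sum_add_distrib]
  map_smul' c A := by
    simp only [evalDiag, Pi.smul_apply, smul_eq_mul, mul_assoc, Finset.mul_sum, RingHom.id_apply]

theorem evalDiagLinear_apply (A : Fin n → Fin n → Fin n → Fin n → ℂ) (u v : Cn n) :
    evalDiagLinear u v A = evalDiag A u v :=
  rfl

theorem evalDiag_real_smul (A : Fin n → Fin n → Fin n → Fin n → ℂ) (r : ℝ) (u v : Cn n) :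
    evalDiag A (r • u) (r • v) = (r ^ 4 : ℝ) * evalDiag A u v := by
  simp only [evalDiag, Finset.mul_sum]
  refine Finset.sum_congr rfl fun i _ => Finset.sum_congr rfl fun j _ =>
    Finset.sum_congr rfl fun k _ => Finset.sum_congr rfl fun l _ => ?_
  simp only [PiLp.smul_apply, Complex.real_smul, map_mul, Complex.conj_ofReal]
  push_cast
  ring

theorem evalDiag_comm {A : Fin n → Fin n → Fin n → Fin n → ℂ}
    (hA : ∀ i j k l, A i j k l = A k l i j) (u v : Cn n) : evalDiag A u v = evalDiag A v u := by
  simp only [evalDiag, ← Fintype.sum_prod_type']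
  refine Fintype.sum_equiv ⟨fun (i, j, k, l) => (k, l, i, j), fun (i, j, k, l) => (k, l, i, j),
    fun _ => rfl, fun _ => rfl⟩ _ _ fun (i, j, k, l) => ?_
  simp only [Equiv.coe_fn_mk, hA i j k l]
  ring

theorem evalDiag_mul (A B : Matrix (Fin n) (Fin n) ℂ) (u v : Cn n) :
    evalDiag (fun i j k l => A i j * B k l) u v = sesq A u u * sesq B v v := by
  simp only [evalDiag, sesq_apply, ← Fintype.sum_prod_type', Finset.sum_mul_sum]
  refine Fintype.sum_equiv (Equiv.prodAssoc _ _ _).symm _ _ fun (i, j, k, l) => ?_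
  simp only [Equiv.prodAssoc_symm_apply]
  ring

theorem evalDiag_mul_conj (A B : Matrix (Fin n) (Fin n) ℂ) (u v : Cn n) :
    evalDiag (fun i j k l => A k j * conj (B l i)) u v = sesq A v u * conj (sesq B v u) := by
  simp only [evalDiag, sesq_apply, ← Fintype.sum_prod_type', map_sum, map_mul, Complex.conj_conj,
    Finset.sum_mul_sum]
  refine Fintype.sum_equiv ⟨fun (i, j, k, l) => ((k, j), (l, i)),
    fun ((k, j), (l, i)) => (i, j, k, l), fun _ => rfl, fun _ => rfl⟩ _ _ fun (i, j, k, l) => ?_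
  simp only [Equiv.coe_fn_mk]
  ring

theorem sesq_eq_of_unitVec {A : Matrix (Fin n) (Fin n) ℂ} {φ : Cn n →ₗ[ℂ] Cn n →ₗ⋆[ℂ] ℂ}
    (hφ : ∀ i j, φ (unitVec i) (unitVec j) = A i j) (u v : Cn n) : sesq A u v = φ u v := by
  conv_rhs => rw [← sum_smul_unitVec u, ← sum_smul_unitVec v]
  simp only [sesq_apply, map_sum, LinearMap.sum_apply, map_smul, map_smulₛₗ, LinearMap.smul_apply,
    smul_eq_mul, Finset.mul_sum, hφ]
  rw [Finset.sum_comm]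
  exact Finset.sum_congr rfl fun _ _ => Finset.sum_congr rfl fun _ _ => by ring

theorem evalDiag_chernCurv_conformal {G' : MetricField n} {F : Cn n → ℝ} (h : HermitianAt G z)
    (hF : ContDiffAt ℝ 2 F z) (hGG : G' =ᶠ[𝓝 z] fun w => Real.exp (F w) • G w) (u v : Cn n) :
    evalDiag (chernCurv G' z) u v = Real.exp (F z) * (evalDiag (chernCurv G z) u v -
      levi (fderiv ℝ (fderiv ℝ fun w => (F w : ℂ)) z) u u * sesq (G z) v v) := by
  set L := levi (fderiv ℝ (fderiv ℝ fun w => (F w : ℂ)) z)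
  have hR : chernCurv G' z = (Real.exp (F z) : ℂ) • (chernCurv G z -
      fun i j k l => L (unitVec i) (unitVec j) * G z k l) := by
    ext i j k l
    exact chernCurv_conformal h hF hGG i j k l
  rw [← sesq_eq_of_unitVec (A := .of fun i j => L (unitVec i) (unitVec j)) fun _ _ => rfl,
    ← evalDiag_mul, ← evalDiagLinear_apply, hR, map_smul, map_sub]
  rfl

/-! ### The tensor `Q` -/

theorem LeeAt.chernTorsionLow_eq {X : Cn n} (hL : LeeAt G z (riemForm (G z) X))
    (h : HermitianAt G z) (k p j : Fin n) :
    chernTorsionLow G z k p j =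
      sesq (G z) (unitVec k) X * G z p j - sesq (G z) (unitVec p) X * G z k j := by
  have hX (u : Cn n) : (riemForm (G z) X u - Complex.I * riemForm (G z) X (Complex.I • u) : ℂ) =
      2 * sesq (G z) u X := by
    rw [riemForm_apply, riemForm_apply, sesq_re_comm h.posDef.isHermitian X,
      sesq_re_comm h.posDef.isHermitian X, sesq_I_left]
    apply Complex.ext <;> simp
  have htors := hL.torsion h.eventually_isHermitian (unitVec k) (unitVec p) (unitVec j)
  simp only [hX, sesq_unitVec] at htors
  simp only [chernTorsionLow, chernTorsion, sub_mul, Finset.sum_sub_distrib,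
    sum_chernGamma_mul h.isUnit, dZ_eq_dMat, sesq_unitVec]
  linear_combination (1 / 2) * htors

theorem sesq_chernTorsionLow {X : Cn n} (hL : LeeAt G z (riemForm (G z) X))
    (h : HermitianAt G z) (p : Fin n) (u v : Cn n) :
    sesq (.of fun k j => chernTorsionLow G z k p j) u v =
      sesq (G z) u X * sesq (G z) (unitVec p) v - sesq (G z) (unitVec p) X * sesq (G z) u v := by
  let T : Cn n →ₗ[ℂ] Cn n →ₗ⋆[ℂ] ℂ := ((sesq (G z)).flip X).smulRight (sesq (G z) (unitVec p)) -
    sesq (G z) (unitVec p) X • sesq (G z)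
  refine sesq_eq_of_unitVec (φ := T) (fun k j => ?_) u v
  simp [T, hL.chernTorsionLow_eq h, sesq_unitVec]

theorem sum_invMetric_mul (h : IsUnit (G z)) (u : Cn n) :
    ∑ p, ∑ q, invMetric G z p q * (sesq (G z) (unitVec p) u * conj (sesq (G z) (unitVec q) u)) =
      conj (sesq (G z) u u) := by
  have hlower : (fun p => sesq (G z) (unitVec p) u) = (G z).mulVec (star u.ofLp) := by
    ext p
    simp [sesq_apply, unitVec_apply, Matrix.mulVec, dotProduct]
  have hraise (q) : ∑ p, invMetric G z p q * sesq (G z) (unitVec p) u = conj (u q) := by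
    change (G z)⁻¹.mulVec (fun p => sesq (G z) (unitVec p) u) q = _
    rw [hlower, Matrix.mulVec_mulVec,
      Matrix.nonsing_inv_mul _ ((Matrix.isUnit_iff_isUnit_det _).1 h), Matrix.one_mulVec]
    rfl
  rw [Finset.sum_comm]
  simp only [← mul_assoc, ← Finset.sum_mul, hraise]
  conv_rhs => enter [2, 1]; rw [← sum_smul_unitVec u]
  simp

theorem evalDiag_tensorQ {X : Cn n} (hL : LeeAt G z (riemForm (G z) X)) (h : HermitianAt G z)
    {u v : Cn n} (huv : sesq (G z) v u = 0) :
    evalDiag (tensorQ G z) u v = evalDiag (chernCurv G z) u v -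
      Complex.normSq (sesq (G z) v X) * conj (sesq (G z) u u) := by
  have hQ : tensorQ G z = chernCurv G z - ∑ p, ∑ q, invMetric G z p q • fun i j k l =>
      chernTorsionLow G z k p j * conj (chernTorsionLow G z l q i) := by
    ext i j k l
    simp [tensorQ, Finset.sum_apply, mul_assoc]
  have hT (p q) : evalDiag (fun i j k l =>
      chernTorsionLow G z k p j * conj (chernTorsionLow G z l q i)) u v =
      Complex.normSq (sesq (G z) v X) *
        (sesq (G z) (unitVec p) u * conj (sesq (G z) (unitVec q) u)) := by
    refine (evalDiag_mul_conj (.of fun k j => chernTorsionLow G z k p j)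
      (.of fun l i => chernTorsionLow G z l q i) u v).trans ?_
    rw [sesq_chernTorsionLow hL h, sesq_chernTorsionLow hL h, huv, ← Complex.mul_conj]
    simp only [mul_zero, sub_zero, map_mul]
    ring
  rw [← evalDiagLinear_apply, hQ]
  simp only [map_sub, map_sum, map_smul, evalDiagLinear_apply, hT, smul_eq_mul,
    mul_left_comm (invMetric G z _ _), ← sum_invMetric_mul h.isUnit, Finset.mul_sum]

/-! ### The local criterion -/

theorem bessel {ι : Type*} [DecidableEq ι] {A : Matrix (Fin n) (Fin n) ℂ} (hA : A.PosDef)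
    {ε : ι → Cn n} (hε : ∀ a b, sesq A (ε a) (ε b) = if a = b then 1 else 0) (s : Finset ι)
    (X : Cn n) : ∑ a ∈ s, Complex.normSq (sesq A (ε a) X) ≤ (sesq A X X).re := by
  obtain ⟨hH, hpos⟩ := posDef_iff_sesq.1 hA
  set P := ∑ a ∈ s, sesq A X (ε a) • ε a with hP
  have hεP (a) (ha : a ∈ s) : sesq A (ε a) P = sesq A (ε a) X := by
    simp [hP, hε, ha, sesq_conj hH]
  have hPP : sesq A P P = sesq A P X := by
    have hsum (Y) : sesq A P Y = ∑ a ∈ s, sesq A X (ε a) * sesq A (ε a) Y := by simp [hP]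
    rw [hsum, hsum]
    exact Finset.sum_congr rfl fun a ha => by rw [hεP a ha]
  have hPX : sesq A P X = ((∑ a ∈ s, Complex.normSq (sesq A (ε a) X) : ℝ) : ℂ) := by
    simp [hP, ← Complex.mul_conj, sesq_conj hH, mul_comm]
  have hXP : sesq A X P = sesq A P X := by
    rw [← sesq_conj hH, hPX, Complex.conj_ofReal]
  have hnonneg : 0 ≤ (sesq A (X - P) (X - P)).re := by
    obtain h | h := eq_or_ne (X - P) 0
    · simp [h]
    · exact (hpos _ h).le
  simpa [hPP, hXP, hPX] using hnonneg

theorem sum_mul_sq_sub_mul_nonneg {ι : Type*} [Fintype ι] {A B : ι → ι → ℝ}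
    (hA : ∀ k m, A k m = A m k) (hAB : ∀ k m, k ≠ m → B k m = A k m) {lam : ι → ℝ}
    (hnonneg : 0 ≤ ∑ k, ∑ m, A k m * (lam m - lam k) ^ 2) :
    0 ≤ ∑ k, ∑ m, B k m * (lam k ^ 2 - lam k * lam m) := by
  have hBA : ∑ k, ∑ m, B k m * (lam k ^ 2 - lam k * lam m) =
      ∑ k, ∑ m, A k m * (lam k ^ 2 - lam k * lam m) := by
    refine Finset.sum_congr rfl fun k _ => Finset.sum_congr rfl fun m _ => ?_
    obtain rfl | hkm := eq_or_ne k m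
    · ring
    · rw [hAB k m hkm]
  have hswap : ∑ k, ∑ m, A k m * (lam k ^ 2 - lam k * lam m) =
      ∑ k, ∑ m, A k m * (lam m ^ 2 - lam k * lam m) := by
    rw [Finset.sum_comm]
    exact Finset.sum_congr rfl fun k _ => Finset.sum_congr rfl fun m _ => by rw [hA]; ring
  have hsum : ∑ k, ∑ m, A k m * (lam m - lam k) ^ 2 =
      ∑ k, ∑ m, A k m * (lam k ^ 2 - lam k * lam m) +
        ∑ k, ∑ m, A k m * (lam m ^ 2 - lam k * lam m) := by
    simp only [← Finset.sum_add_distrib]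
    exact Finset.sum_congr rfl fun k _ => Finset.sum_congr rfl fun m _ => by ring
  linarith

/-- `Q`-nonnegativity at a point of a coordinate domain. -/
def QNonnegAt (G : MetricField n) (z : Cn n) : Prop :=
  ∀ ε : Fin n → Cn n, IsUnitaryFrame G z ε → ∀ lam : Fin n → ℝ,
    0 ≤ ∑ k, ∑ m, (evalDiag (tensorQ G z) (ε m) (ε k)).re * (lam k ^ 2 - lam k * lam m)

/-- Nonnegative quadratic orthogonal bisectional curvature at a point of a coordinate domain. -/
def NonnegQuadOrthBisectionalAt (G : MetricField n) (z : Cn n) : Prop :=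
  ∀ ε : Fin n → Cn n, IsUnitaryFrame G z ε → ∀ lam : Fin n → ℝ,
    0 ≤ ∑ k, ∑ m, (evalDiag (chernCurv G z) (ε m) (ε k)).re * (lam m - lam k) ^ 2

theorem IsUnitaryFrame.of_eq_exp_smul {G' : MetricField n} {c : ℝ}
    (hGG : G' z = Real.exp c • G z) {ε : Fin n → Cn n} (hε : IsUnitaryFrame G z ε) :
    IsUnitaryFrame G' z fun k => Real.exp (-c / 2) • ε k := by
  intro a b
  have hc : Real.exp (-c / 2) * (Real.exp (-c / 2) * Real.exp c) = 1 := by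
    rw [← Real.exp_add, ← Real.exp_add, Real.exp_eq_one_iff]
    ring
  rw [herm_eq_sesq, sesq_real_smul_left, sesq_real_smul_right, hGG, sesq_real_smul, ← hε a b,
    herm_eq_sesq, ← mul_assoc, ← mul_assoc]
  norm_cast
  rw [mul_assoc (Real.exp _), hc, Complex.ofReal_one, one_mul]

theorem NonnegQuadOrthBisectionalAt.sum_nonneg {G' : MetricField n} {c : ℝ}
    (hR : NonnegQuadOrthBisectionalAt G' z) (hGG : G' z = Real.exp c • G z)
    {ε : Fin n → Cn n} (hε : IsUnitaryFrame G z ε) (lam : Fin n → ℝ) :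
    0 ≤ ∑ k, ∑ m, (evalDiag (chernCurv G' z) (ε m) (ε k)).re * (lam m - lam k) ^ 2 := by
  have h := hR _ (hε.of_eq_exp_smul hGG) lam
  simp only [evalDiag_real_smul, Complex.re_ofReal_mul, mul_assoc, ← Finset.mul_sum] at h
  exact nonneg_of_mul_nonneg_right h (by positivity)

section Criterion

variable {G' : MetricField n} {F : Cn n → ℝ} {X : Cn n}

theorem evalDiag_tensorQ_re_of_parallel (h : HermitianAt G z) (hF : ContDiffAt ℝ 2 F z)
    (hGG : G' =ᶠ[𝓝 z] fun w => Real.exp (F w) • G w) (hL : LeeAt G z (riemForm (G z) X))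
    (hP : ParallelAt G F z X) {u v : Cn n} (huu : sesq (G z) u u = 1) (hvv : sesq (G z) v v = 1)
    (hvu : sesq (G z) v u = 0) :
    (evalDiag (tensorQ G z) u v).re =
      (Real.exp (F z))⁻¹ * (evalDiag (chernCurv G' z) u v).re + ((sesq (G z) X X).re -
        Complex.normSq (sesq (G z) u X) - Complex.normSq (sesq (G z) v X)) := by
  rw [evalDiag_tensorQ hL h hvu, evalDiag_chernCurv_conformal h hF hGG, levi_ofReal_self hF,
    complexHessian_of_parallel h.eventually_isHermitian hL hP, huu, hvv]
  simp only [Complex.re_ofReal_mul, Complex.sub_re, map_one, mul_one, Complex.ofReal_re,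
    Complex.one_re]
  field_simp
  ring

theorem qNonnegAt_of_parallel (h : HermitianAt G z) (h' : HermitianAt G' z)
    (hF : ContDiffAt ℝ 2 F z) (hGG : G' =ᶠ[𝓝 z] fun w => Real.exp (F w) • G w)
    (hK : ∀ᶠ w in 𝓝 z, LeeAt G' w 0) (hL : LeeAt G z (riemForm (G z) X))
    (hP : ParallelAt G F z X) (hR : NonnegQuadOrthBisectionalAt G' z) : QNonnegAt G z := by
  intro ε hε lam
  have hunit (k m) : sesq (G z) (ε k) (ε m) = if k = m then 1 else 0 := hε k m
  set E := (Real.exp (F z))⁻¹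
  set R := fun k m => (evalDiag (chernCurv G' z) (ε m) (ε k)).re with hR_def
  set N := fun k m => (sesq (G z) X X).re - Complex.normSq (sesq (G z) (ε m) X) -
    Complex.normSq (sesq (G z) (ε k) X) with hN_def
  have hsymm (k m) : E * R k m + N k m = E * R m k + N m k := by
    simp only [hR_def, hN_def, evalDiag_comm (h'.chernCurv_symm hK) (ε m)]
    ring
  have hQ (k m) (hkm : k ≠ m) : (evalDiag (tensorQ G z) (ε m) (ε k)).re = E * R k m + N k m :=
    evalDiag_tensorQ_re_of_parallel h hF hGG hL hP (by simp [hunit]) (by simp [hunit])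
      (by simp [hunit, hkm])
  have hRnonneg : 0 ≤ ∑ k, ∑ m, E * (R k m * (lam m - lam k) ^ 2) := by
    simp only [← Finset.mul_sum]
    exact mul_nonneg (by positivity) (hR.sum_nonneg hGG.eq_of_nhds hε lam)
  have hNnonneg : 0 ≤ ∑ k, ∑ m, N k m * (lam m - lam k) ^ 2 := by
    refine Finset.sum_nonneg fun k _ => Finset.sum_nonneg fun m _ => ?_
    obtain rfl | hkm := eq_or_ne k m
    · simp
    · have := bessel h.posDef hunit {k, m} X
      rw [Finset.sum_pair hkm] at this
      exact mul_nonneg (by simp only [hN_def]; linarith) (sq_nonneg _)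
  refine sum_mul_sq_sub_mul_nonneg hsymm hQ ?_
  simpa only [add_mul, mul_assoc, Finset.sum_add_distrib] using add_nonneg hRnonneg hNnonneg

theorem LeeAt.unique (hn : 2 ≤ n) (hG : (G z).PosDef) {l l' : Cn n →ₗ[ℝ] ℝ} (h : LeeAt G z l)
    (h' : LeeAt G z l') : l = l' := by
  obtain ⟨hH, hpos⟩ := posDef_iff_sesq.1 hG
  ext u
  have hker : LinearMap.ker ((sesq (G z)).flip u : Cn n →ₗ[ℂ] ℂ) ≠ ⊥ := by
    apply LinearMap.ker_ne_bot_of_finrank_lt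
    rw [Module.finrank_self, finrank_euclideanSpace_fin]
    omega
  obtain ⟨v, hvu : sesq (G z) v u = 0, hv0⟩ := Submodule.exists_mem_ne_zero_of_ne_bot hker
  have huv : sesq (G z) u v = 0 := by rw [← sesq_conj hH, hvu, map_zero]
  have heq := (h u v (Complex.I • v)).symm.trans (h' u v (Complex.I • v))
  simp only [sesq_I_left, sesq_I_right, huv, hvu, mul_zero, Complex.zero_im, add_zero,
    Complex.mul_im, Complex.neg_re, Complex.neg_im, Complex.I_re, Complex.I_im] at heq
  have hmul : (l u - l' u) * (sesq (G z) v v).re = 0 := by linear_combination -heq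
  exact sub_eq_zero.1 ((mul_eq_zero.1 hmul).resolve_right (hpos v hv0).ne')

theorem contDiffAt_log_ratio (h : HermitianAt G z) (h' : HermitianAt G' z) (i : Fin n)
    (hGG : G' =ᶠ[𝓝 z] fun w => Real.exp (F w) • G w) : ContDiffAt ℝ 2 F z := by
  have hre {H : MetricField n} (hH : HermitianAt H z) :
      ContDiffAt ℝ 2 (fun w => (H w i i).re) z :=
    Complex.reCLM.contDiff.contDiffAt.comp z (hH.contDiff i i)
  have hpos {H : MetricField n} {w : Cn n} (hH : HermitianAt H w) : 0 < (H w i i).re :=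
    (Complex.pos_iff.1 (hH.posDef.diag_pos)).1
  have hlog : F =ᶠ[𝓝 z] fun w => Real.log (G' w i i).re - Real.log (G w i i).re := by
    filter_upwards [h.eventually, hGG] with w hw hGGw
    rw [hGGw, Matrix.smul_apply, Complex.smul_re, smul_eq_mul,
      Real.log_mul (Real.exp_pos _).ne' (hpos hw).ne', Real.log_exp, add_sub_cancel_right]
  exact (((hre h').log (hpos h').ne').sub ((hre h).log (hpos h).ne')).congr_of_eventuallyEq hlog

theorem qNonnegAt_of_conformal_kahler (h : HermitianAt G z) (h' : HermitianAt G' z)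
    (hGG : G' =ᶠ[𝓝 z] fun w => Real.exp (F w) • G w) {θ : CovectorField n}
    (hL : ∀ᶠ w in 𝓝 z, ∀ a b c, dFundForm G w a b c = wedgeFund θ G w a b c)
    (hP : ∀ a b, nablaCovector G θ z a b = 0)
    (hK : ∀ᶠ w in 𝓝 z, ∀ a b c, dFundForm G' w a b c = 0)
    (hR : NonnegQuadOrthBisectionalAt G' z) : QNonnegAt G z := by
  obtain hn | hn := lt_or_ge n 2
  · have : Subsingleton (Fin n) := Fin.subsingleton_iff_le_one.2 (by omega)
    intro ε _ lam
    refine (Finset.sum_eq_zero fun k _ => Finset.sum_eq_zero fun m _ => ?_).ge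
    rw [Subsingleton.elim m k]
    ring
  have hF := contDiffAt_log_ratio h h' ⟨0, by omega⟩ hGG
  have hK₀ : ∀ᶠ w in 𝓝 z, LeeAt G' w 0 := by
    filter_upwards [h'.eventually, hK] with w hw hKw
    exact (leeAt_iff hw.differentiableAt (θ := 0) fun _ => rfl).2 (by simpa [wedgeFund] using hKw)
  have hθ : ∀ᶠ w in 𝓝 z, (realBasis n).constr ℝ (θ w) = -(fderiv ℝ F w : Cn n →ₗ[ℝ] ℝ) ∧
      LeeAt G w (-(fderiv ℝ F w : Cn n →ₗ[ℝ] ℝ)) := by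
    filter_upwards [h.eventually, hF.eventually (by simp), hGG.eventually_nhds, hL, hK₀]
      with w hw hFw hGGw hLw hKw
    have hlee := hKw.of_conformal hw.differentiableAt (hFw.differentiableAt (by norm_num)) hGGw
    rw [zero_sub] at hlee
    exact ⟨LeeAt.unique hn hw.posDef ((leeAt_iff hw.differentiableAt fun a => by
      rw [← realBasis_apply, Module.Basis.constr_basis]).2 hLw) hlee, hlee⟩
  have hθF : ∀ᶠ w in 𝓝 z, ∀ a, θ w a = -fderiv ℝ F w (realVec a) := hθ.mono fun w hw a => by
    rw [← (realBasis n).constr_basis ℝ (θ w) a, hw.1, realBasis_apply]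
    rfl
  obtain ⟨X, hX⟩ := exists_riemForm_eq h.posDef (-(fderiv ℝ F z : Cn n →ₗ[ℝ] ℝ))
  exact qNonnegAt_of_parallel h h' hF hGG hK₀ (hX ▸ hθ.self_of_nhds.2)
    ((parallelAt_iff h.differentiableAt h.posDef (differentiableAt_fderiv hF) hθF hX).2 hP) hR

end Criterion

/-! ### Kähler covers of Vaisman manifolds -/

section KahlerCover

variable {M : Type*} [TopologicalSpace M] [ChartedSpace (Cn n) M]
  {e : OpenPartialHomeomorph M (Cn n)}

theorem tangentOf_add (e : OpenPartialHomeomorph M (Cn n)) (z u v : Cn n) :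
    tangentOf e z (u + v) = tangentOf e z u + tangentOf e z v :=
  (mfderiv 𝓘(ℂ, Cn n) 𝓘(ℂ, Cn n) e.symm z).map_add u v

theorem tangentOf_smul (e : OpenPartialHomeomorph M (Cn n)) (z : Cn n) (c : ℂ) (u : Cn n) :
    tangentOf e z (c • u) = c • tangentOf e z u :=
  (mfderiv 𝓘(ℂ, Cn n) 𝓘(ℂ, Cn n) e.symm z).map_smul c u

theorem HermitianMetric.sesq_coord (g : HermitianMetric n M)
    (e : OpenPartialHomeomorph M (Cn n)) (z u v : Cn n) :
    sesq (g.coord e z) u v = g.form (e.symm z) (tangentOf e z u) (tangentOf e z v) := by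
  let φ : Cn n →ₗ[ℂ] Cn n →ₗ⋆[ℂ] ℂ := LinearMap.mk₂'ₛₗ (RingHom.id ℂ) (starRingEnd ℂ)
    (fun u v => g.form (e.symm z) (tangentOf e z u) (tangentOf e z v))
    (fun u u' v => by rw [tangentOf_add, map_add, LinearMap.add_apply])
    (fun c u v => by rw [tangentOf_smul, map_smul]; rfl)
    (fun u v v' => by rw [tangentOf_add, map_add])
    (fun c u v => by rw [tangentOf_smul, map_smulₛₗ])
  exact sesq_eq_of_unitVec (φ := φ) (fun _ _ => rfl) u v

theorem HermitianMetric.form_congr (g : HermitianMetric n M) {x y : M} (h : x = y)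
    (u v : Cn n) : g.form x u v = g.form y u v := by
  subst h
  rfl

theorem mdifferentiable_of_mem_holoCharts (he : e ∈ holoCharts n M) :
    e.MDifferentiable 𝓘(ℂ, Cn n) 𝓘(ℂ, Cn n) :=
  ⟨(contMDiffOn_of_mem_maximalAtlas he).mdifferentiableOn (by simp),
    (contMDiffOn_symm_of_mem_maximalAtlas he).mdifferentiableOn (by simp)⟩

theorem tangentOf_injective (he : e ∈ holoCharts n M) (hz : z ∈ e.target) :
    Function.Injective (tangentOf e z) :=
  (mdifferentiable_of_mem_holoCharts he).symm.mfderiv_injective hz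

theorem HermitianMetric.hermitianAt_coord (g : HermitianMetric n M) (he : e ∈ holoCharts n M)
    (hz : z ∈ e.target) : HermitianAt (g.coord e) z where
  contDiff i j :=
    ((g.smooth e he i j).contDiffAt (e.open_target.mem_nhds hz)).of_le ENat.LEInfty.out
  eventually_posDef := by
    filter_upwards [e.open_target.mem_nhds hz] with w hw
    refine posDef_iff_sesq.2 ⟨Matrix.IsHermitian.ext fun i j => g.conj_symm _ _ _, fun u hu => ?_⟩
    rw [g.sesq_coord]
    exact g.pos _ _ fun h => hu (tangentOf_injective he hw
      (h.trans (ContinuousLinearMap.map_zero _).symm))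

variable {N : Type*} [TopologicalSpace N] [ChartedSpace (Cn n) N] {π : N → M}
  {e' : OpenPartialHomeomorph N (Cn n)}

theorem mfderiv_tangentOf (hπ : MDifferentiableAt 𝓘(ℂ, Cn n) 𝓘(ℂ, Cn n) π (e'.symm z))
    (he' : e' ∈ holoCharts n N) (hz : z ∈ e'.target) (h : π ∘ e'.symm =ᶠ[𝓝 z] e.symm)
    (u : Cn n) :
    mfderiv 𝓘(ℂ, Cn n) 𝓘(ℂ, Cn n) π (e'.symm z) (tangentOf e' z u) = (tangentOf e z u : Cn n) := by
  have hcomp := mfderiv_comp z hπ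
    ((mdifferentiable_of_mem_holoCharts he').mdifferentiableAt_symm hz)
  have hcongr := h.mfderiv_eq (I := 𝓘(ℂ, Cn n)) (I' := 𝓘(ℂ, Cn n))
  exact congrArg (fun L : Cn n →L[ℂ] Cn n => L u) (hcomp.symm.trans hcongr)

variable [IsManifold 𝓘(ℂ, Cn n) ω N]

theorem exists_holoChart_of_isLocalDiffeomorph
    (hπ : IsLocalDiffeomorph 𝓘(ℂ, Cn n) 𝓘(ℂ, Cn n) ω π) (he : e ∈ holoCharts n M)
    (hz : z ∈ e.target) {x : N} (hx : π x = e.symm z) :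
    ∃ e' ∈ holoCharts n N, z ∈ e'.target ∧
      ∀ w ∈ e'.target, w ∈ e.target ∧ π (e'.symm w) = e.symm w := by
  obtain ⟨Φ, hxΦ, hΦ⟩ := hπ x
  refine ⟨Φ.toOpenPartialHomeomorph ≫ₕ e, ?_, ⟨hz, ?_⟩, ?_⟩
  · rw [holoCharts, IsManifold.mem_maximalAtlas_iff_contMDiffOn]
    constructor
    · exact (contMDiffOn_of_mem_maximalAtlas he).comp (Φ.contMDiffOn_toFun.mono fun y hy => hy.1)
        fun y hy => hy.2
    · exact Φ.contMDiffOn_invFun.comp ((contMDiffOn_symm_of_mem_maximalAtlas he).mono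
        fun y hy => hy.1) fun y hy => hy.2
  · change e.symm z ∈ Φ.target
    rw [← hx, hΦ hxΦ]
    exact Φ.map_source hxΦ
  · rintro w ⟨hw, hwΦ : e.symm w ∈ Φ.target⟩
    exact ⟨hw, (hΦ (Φ.map_target hwΦ)).trans (Φ.right_inv hwΦ)⟩

theorem qNonneg_of_conformal_kahler {g : HermitianMetric n M} {g' : HermitianMetric n N}
    (hg : IsVaisman g) (hsurj : Function.Surjective π)
    (hπ : IsLocalDiffeomorph 𝓘(ℂ, Cn n) 𝓘(ℂ, Cn n) ω π) (hg' : IsKahler g') {f : N → ℝ}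
    (hf : ∀ (x : N) (u v : TangentSpace 𝓘(ℂ, Cn n) x),
      g'.form x u v = (Real.exp (f x) : ℂ) * g.form (π x)
        (mfderiv 𝓘(ℂ, Cn n) 𝓘(ℂ, Cn n) π x u) (mfderiv 𝓘(ℂ, Cn n) 𝓘(ℂ, Cn n) π x v))
    (hR : NonnegQuadOrthBisectional g') : QNonneg g := by
  intro e he z hz
  obtain ⟨θ, hL, hP⟩ := hg
  obtain ⟨x, hx⟩ := hsurj (e.symm z)
  obtain ⟨e', he', hz', hee'⟩ := exists_holoChart_of_isLocalDiffeomorph hπ he hz hx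
  have hnhds : ∀ᶠ w in 𝓝 z, w ∈ e'.target := e'.open_target.mem_nhds hz'
  have hconf : g'.coord e' =ᶠ[𝓝 z] fun w => Real.exp (f (e'.symm w)) • g.coord e w := by
    filter_upwards [hnhds] with w hw
    have hlift : π ∘ e'.symm =ᶠ[𝓝 w] e.symm := by
      filter_upwards [e'.open_target.mem_nhds hw] with y hy using (hee' y hy).2
    have htan := mfderiv_tangentOf ((hπ _).mdifferentiableAt (by simp)) he' hw hlift
    ext i j
    refine (hf _ _ _).trans (congrArg _ ((g.form_congr (hee' w hw).2 _ _).trans ?_))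
    rw [htan, htan]
    rfl
  exact qNonnegAt_of_conformal_kahler (g.hermitianAt_coord he hz) (g'.hermitianAt_coord he' hz')
    hconf (hnhds.mono fun w hw => (hL e he w (hee' w hw).1).2) (hP e he z hz)
    (hnhds.mono fun w hw => hg' e' he' w hw) (hR e' he' z hz')

end KahlerCover

/-! ### The flat metric in holomorphic coordinates -/

/-- `φ` is a holomorphic coordinate system of `ℂⁿ` near `z`. -/
structure CoordChangeAt (φ : Cn n → Cn n) (z : Cn n) : Prop where
  contDiff : ContDiffAt ℂ ω φ z
  invertible : (fderiv ℂ φ z).IsInvertible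

/-- The flat metric of `ℂⁿ` in the coordinates `φ`. -/
def flatPullback (φ : Cn n → Cn n) : MetricField n := fun w =>
  .of fun i j => inner ℂ (fderiv ℂ φ w (unitVec j)) (fderiv ℂ φ w (unitVec i))

theorem fderiv_inner_of_differentiableAt_complex {f g : Cn n → Cn n} (hf : DifferentiableAt ℂ f z)
    (hg : DifferentiableAt ℂ g z) (u : Cn n) :
    fderiv ℝ (fun w => inner ℂ (f w) (g w)) z u =
      inner ℂ (f z) (fderiv ℂ g z u) + inner ℂ (fderiv ℂ f z u) (g z) := by
  rw [fderiv_inner_apply ℂ (hf.restrictScalars ℝ) (hg.restrictScalars ℝ),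
    hf.fderiv_restrictScalars ℝ, hg.fderiv_restrictScalars ℝ]
  rfl

theorem dZbar_eq_zero_of_differentiableAt_complex {f : Cn n → ℂ} (hf : DifferentiableAt ℂ f z)
    (i : Fin n) : dZbar i f z = 0 := by
  simp only [dZbar, hf.fderiv_restrictScalars ℝ, ContinuousLinearMap.coe_restrictScalars', map_smul,
    smul_eq_mul, ← mul_assoc, Complex.I_mul_I]
  ring

section FlatMetric

variable {φ : Cn n → Cn n}

theorem sesq_flatPullback (w u v : Cn n) :
    sesq (flatPullback φ w) u v = inner ℂ (fderiv ℂ φ w v) (fderiv ℂ φ w u) :=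
  let L : Cn n →ₗ[ℂ] Cn n := fderiv ℂ φ w
  sesq_eq_of_unitVec (φ := (((innerₛₗ ℂ).comp L).flip.comp L)) (fun _ _ => rfl) u v

namespace CoordChangeAt

theorem differentiableAt (h : CoordChangeAt φ z) : DifferentiableAt ℂ φ z :=
  h.contDiff.differentiableAt (by simp)

theorem contDiffAt_fderiv (h : CoordChangeAt φ z) : ContDiffAt ℂ ω (fderiv ℂ φ) z :=
  h.contDiff.fderiv_right (by simp)

theorem contDiffAt_fderiv_apply (h : CoordChangeAt φ z) (u : Cn n) :
    ContDiffAt ℂ ω (fun w => fderiv ℂ φ w u) z :=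
  h.contDiffAt_fderiv.clm_apply contDiffAt_const

theorem differentiableAt_fderiv_apply (h : CoordChangeAt φ z) (u : Cn n) :
    DifferentiableAt ℂ (fun w => fderiv ℂ φ w u) z :=
  (h.contDiffAt_fderiv_apply u).differentiableAt (by simp)

theorem eventually (h : CoordChangeAt φ z) : ∀ᶠ w in 𝓝 z, CoordChangeAt φ w := by
  obtain ⟨e, he⟩ := h.invertible
  have hinv : ∀ᶠ w in 𝓝 z, (fderiv ℂ φ w).IsInvertible :=
    h.contDiffAt_fderiv.continuousAt.eventually_mem (he ▸ ContinuousLinearEquiv.nhds e)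
  filter_upwards [h.contDiff.eventually (by simp), hinv] with w hw hw' using ⟨hw, hw'⟩

theorem fderiv_fderiv_apply (h : CoordChangeAt φ z) (u v : Cn n) :
    fderiv ℂ (fun w => fderiv ℂ φ w v) z u = fderiv ℂ (fderiv ℂ φ) z u v := by
  have h' := h.contDiffAt_fderiv.differentiableAt (by simp)
  rw [fderiv_clm_apply h' (differentiableAt_const v)]
  simp

theorem fderiv_fderiv_comm (h : CoordChangeAt φ z) (u v : Cn n) :
    fderiv ℂ (fderiv ℂ φ) z u v = fderiv ℂ (fderiv ℂ φ) z v u :=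
  h.contDiff.isSymmSndFDerivAt (by simp) u v

theorem hermitianAt (h : CoordChangeAt φ z) : HermitianAt (flatPullback φ) z where
  contDiff i j := by
    have hC (u : Cn n) : ContDiffAt ℝ 2 (fun w => fderiv ℂ φ w u) z :=
      ((h.contDiffAt_fderiv_apply u).restrict_scalars ℝ).of_le (by simp)
    exact (hC _).inner ℂ (hC _)
  eventually_posDef := by
    filter_upwards [h.eventually] with w hw
    refine posDef_iff_sesq.2 ⟨Matrix.IsHermitian.ext fun i j => ?_, fun u hu => ?_⟩
    · exact inner_conj_symm (fderiv ℂ φ w (unitVec j)) (fderiv ℂ φ w (unitVec i))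
    · rw [sesq_flatPullback]
      exact re_inner_self_pos (𝕜 := ℂ) |>.2 fun h0 =>
        hu (hw.invertible.injective (h0.trans (map_zero _).symm))

theorem sesq_dMat (h : CoordChangeAt φ z) (d u v : Cn n) :
    sesq (dMat (flatPullback φ) z d) u v =
      inner ℂ (fderiv ℂ φ z v) (fderiv ℂ (fderiv ℂ φ) z d u) +
        inner ℂ (fderiv ℂ (fderiv ℂ φ) z d v) (fderiv ℂ φ z u) := by
  rw [← fderiv_herm h.hermitianAt.differentiableAt]
  simp only [herm_eq_sesq, sesq_flatPullback]
  rw [fderiv_inner_of_differentiableAt_complex (h.differentiableAt_fderiv_apply _)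
    (h.differentiableAt_fderiv_apply _), h.fderiv_fderiv_apply, h.fderiv_fderiv_apply]

theorem leeAt_zero (h : CoordChangeAt φ z) : LeeAt (flatPullback φ) z 0 := by
  intro u v w
  have him (x y : Cn n) : (inner ℂ x y : ℂ).im = -(inner ℂ y x : ℂ).im := inner_im_symm (𝕜 := ℂ) x y
  simp only [h.sesq_dMat, Complex.add_im, LinearMap.zero_apply, zero_mul, add_zero]
  rw [h.fderiv_fderiv_comm v u, h.fderiv_fderiv_comm w u, h.fderiv_fderiv_comm w v,
    him (fderiv ℂ φ z w), him (fderiv ℂ φ z u), him (fderiv ℂ φ z v)]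
  ring

theorem koszul_flatPullback (h : CoordChangeAt φ z) (u v w : Cn n) :
    koszul (flatPullback φ) z u v w =
      2 * (inner ℂ (fderiv ℂ φ z w) (fderiv ℂ (fderiv ℂ φ) z u v) : ℂ).re := by
  have hre (x y : Cn n) : (inner ℂ x y : ℂ).re = (inner ℂ y x : ℂ).re := inner_re_symm (𝕜 := ℂ) x y
  simp only [koszul_apply, h.sesq_dMat, Complex.add_re, Complex.sub_re]
  rw [h.fderiv_fderiv_comm w u, h.fderiv_fderiv_comm w v, h.fderiv_fderiv_comm v u,
    hre _ (fderiv ℂ φ z v), hre _ (fderiv ℂ φ z u)]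
  ring

theorem dZ_flatPullback (h : CoordChangeAt φ z) (i k l : Fin n) :
    dZ i (fun w => flatPullback φ w k l) z =
      inner ℂ (fderiv ℂ φ z (unitVec l)) (fderiv ℂ (fderiv ℂ φ) z (unitVec i) (unitVec k)) := by
  rw [dZ_eq_dMat, h.sesq_dMat, h.sesq_dMat]
  simp only [map_smul, smul_apply, inner_smul_left, inner_smul_right, Complex.conj_I]
  linear_combination (-1 / 2 * inner ℂ (fderiv ℂ φ z (unitVec l))
    (fderiv ℂ (fderiv ℂ φ) z (unitVec i) (unitVec k)) + 1 / 2 *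
    inner ℂ (fderiv ℂ (fderiv ℂ φ) z (unitVec i) (unitVec l)) (fderiv ℂ φ z (unitVec k))) *
    Complex.I_sq

theorem chernGamma_flatPullback (h : CoordChangeAt φ z) (i k m : Fin n) :
    chernGamma (flatPullback φ) z i k m =
      (fderiv ℂ φ z).inverse (fderiv ℂ (fderiv ℂ φ) z (unitVec i) (unitVec k)) m := by
  set x := (fderiv ℂ φ z).inverse (fderiv ℂ (fderiv ℂ φ) z (unitVec i) (unitVec k)) with hx
  suffices Matrix.vecMul (chernGamma (flatPullback φ) z i k) (flatPullback φ z) =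
      Matrix.vecMul x (flatPullback φ z) from
    congrFun (Matrix.vecMul_injective_of_isUnit h.hermitianAt.isUnit this) m
  ext l
  calc Matrix.vecMul (chernGamma (flatPullback φ) z i k) (flatPullback φ z) l
      = inner ℂ (fderiv ℂ φ z (unitVec l)) (fderiv ℂ φ z x) := by
        rw [vecMul_chernGamma h.hermitianAt.isUnit]
        beta_reduce
        rw [h.dZ_flatPullback, hx, h.invertible.self_apply_inverse]
    _ = sesq (flatPullback φ z) x (unitVec l) := (sesq_flatPullback _ _ _).symm
    _ = Matrix.vecMul x (flatPullback φ z) l := by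
        simp [sesq_apply, unitVec_apply, Matrix.vecMul, dotProduct, mul_comm]

theorem chernCurv_flatPullback (h : CoordChangeAt φ z) (i j k l : Fin n) :
    chernCurv (flatPullback φ) z i j k l = 0 := by
  have hΓ (m : Fin n) : dZbar j (fun w => chernGamma (flatPullback φ) w i k m) z = 0 := by
    rw [dZbar_congr j (h.eventually.mono fun w hw => hw.chernGamma_flatPullback i k m)]
    have hinv : DifferentiableAt ℂ (fun w => (fderiv ℂ φ w).inverse) z :=
      (h.invertible.contDiffAt_map_inverse.comp z h.contDiffAt_fderiv).differentiableAt
        (n := ω) (by simp)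
    have hD : DifferentiableAt ℂ (fderiv ℂ (fderiv ℂ φ)) z :=
      (h.contDiffAt_fderiv.fderiv_right (m := ω) (by simp)).differentiableAt (by simp)
    exact dZbar_eq_zero_of_differentiableAt_complex (differentiableAt_euclidean.1 (hinv.clm_apply
      ((hD.clm_apply (differentiableAt_const _)).clm_apply (differentiableAt_const _))) m) j
  simp only [chernCurv, hΓ, neg_zero, zero_mul, Finset.sum_const_zero]

end CoordChangeAt

/-! ### The Hopf metric in holomorphic coordinates -/

/-- The logarithm of the ratio between the flat metric and the Hopf metric in the coordinates `φ`:
the components of `4 √-1 ∂∂̄|z|² / |z|²` are `4 δ_{ij} / |z|²`. -/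
def hopfPotential (φ : Cn n → Cn n) (w : Cn n) : ℝ := Real.log (‖φ w‖ ^ 2 / 4)

theorem exp_hopfPotential (h0 : φ z ≠ 0) : Real.exp (hopfPotential φ z) = ‖φ z‖ ^ 2 / 4 :=
  Real.exp_log (by positivity)

theorem contDiffAt_hopfPotential (hφ : ContDiffAt ℂ ω φ z) (h0 : φ z ≠ 0) :
    ContDiffAt ℝ 2 (hopfPotential φ) z :=
  ((((hφ.restrict_scalars ℝ).of_le (by simp)).norm_sq ℂ).div_const 4).log (by positivity)

theorem fderiv_norm_sq_of_differentiableAt_complex (hφ : DifferentiableAt ℂ φ z) (u : Cn n) :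
    fderiv ℝ (fun w => ‖φ w‖ ^ 2) z u = 2 * (inner ℂ (φ z) (fderiv ℂ φ z u) : ℂ).re := by
  have hsq : (fun w => ‖φ w‖ ^ 2) = fun w => (inner ℂ (φ w) (φ w) : ℂ).re :=
    funext fun w => (inner_self_eq_norm_sq (𝕜 := ℂ) (φ w)).symm
  have hre : (inner ℂ (fderiv ℂ φ z u) (φ z) : ℂ).re = (inner ℂ (φ z) (fderiv ℂ φ z u) : ℂ).re :=
    inner_re_symm (𝕜 := ℂ) _ _
  rw [hsq, fderiv_re_apply ((hφ.restrictScalars ℝ).inner ℂ (hφ.restrictScalars ℝ)),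
    fderiv_inner_of_differentiableAt_complex hφ hφ, Complex.add_re, hre]
  ring

theorem norm_sq_mul_fderiv_hopfPotential (hφ : DifferentiableAt ℂ φ z) (h0 : φ z ≠ 0) (u : Cn n) :
    ‖φ z‖ ^ 2 * fderiv ℝ (hopfPotential φ) z u = 2 * (inner ℂ (φ z) (fderiv ℂ φ z u) : ℂ).re := by
  have hN : DifferentiableAt ℝ (fun w => ‖φ w‖ ^ 2) z := (hφ.restrictScalars ℝ).norm_sq ℂ
  have hlog : HasFDerivAt (hopfPotential φ) _ z :=
    (hN.hasFDerivAt.mul_const (4⁻¹ : ℝ)).log (by positivity)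
  rw [hlog.fderiv, ← fderiv_norm_sq_of_differentiableAt_complex hφ]
  simp only [smul_apply, smul_eq_mul]
  field_simp

namespace CoordChangeAt

theorem norm_sq_mul_hessian_hopfPotential (h : CoordChangeAt φ z) (h0 : φ z ≠ 0) (u v : Cn n) :
    ‖φ z‖ ^ 2 * (fderiv ℝ (fderiv ℝ (hopfPotential φ)) z u v +
        fderiv ℝ (hopfPotential φ) z u * fderiv ℝ (hopfPotential φ) z v) =
      2 * (inner ℂ (φ z) (fderiv ℂ (fderiv ℂ φ) z u v) : ℂ).re +
        2 * (inner ℂ (fderiv ℂ φ z u) (fderiv ℂ φ z v) : ℂ).re := by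
  have hφ := h.differentiableAt
  have hE : (fun w => ‖φ w‖ ^ 2 * fderiv ℝ (hopfPotential φ) w v) =ᶠ[𝓝 z]
      fun w => 2 * (inner ℂ (φ w) (fderiv ℂ φ w v) : ℂ).re := by
    filter_upwards [h.eventually, hφ.continuousAt.eventually_ne h0] with w hw hne
      using norm_sq_mul_fderiv_hopfPotential hw.differentiableAt hne v
  have hN : DifferentiableAt ℝ (fun w => ‖φ w‖ ^ 2) z := (hφ.restrictScalars ℝ).norm_sq ℂ
  have hdF := hasFDerivAt_fderiv_apply (contDiffAt_hopfPotential h.contDiff h0) v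
  have hin : DifferentiableAt ℝ (fun w => (inner ℂ (φ w) (fderiv ℂ φ w v) : ℂ)) z :=
    (hφ.restrictScalars ℝ).inner ℂ ((h.differentiableAt_fderiv_apply v).restrictScalars ℝ)
  have hre : DifferentiableAt ℝ (fun w => (inner ℂ (φ w) (fderiv ℂ φ w v) : ℂ).re) z :=
    Complex.reCLM.differentiableAt.comp z hin
  have key := congrArg (fun L : Cn n →L[ℝ] ℝ => L u) hE.fderiv_eq
  rw [fderiv_fun_mul hN hdF.differentiableAt, hdF.fderiv,
    fderiv_const_mul hre] at key
  simp only [add_apply, smul_apply, smul_eq_mul, ContinuousLinearMap.comp_apply,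
    ContinuousLinearMap.apply_apply, fderiv_norm_sq_of_differentiableAt_complex hφ,
    fderiv_re_apply hin,
    fderiv_inner_of_differentiableAt_complex hφ (h.differentiableAt_fderiv_apply v),
    h.fderiv_fderiv_apply, Complex.add_re] at key
  linear_combination key +
    fderiv ℝ (hopfPotential φ) z v * norm_sq_mul_fderiv_hopfPotential hφ h0 u

theorem re_sesq_flatPullback_eq (h : CoordChangeAt φ z) (h0 : φ z ≠ 0) {X : Cn n}
    (hX : fderiv ℂ φ z X = ((-(1 / 4) : ℝ) : ℂ) • φ z) (u : Cn n) :
    (sesq (flatPullback φ z) u X).re = -(‖φ z‖ ^ 2 / 8) * fderiv ℝ (hopfPotential φ) z u := by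
  have hFu := norm_sq_mul_fderiv_hopfPotential h.differentiableAt h0 u
  rw [sesq_flatPullback, hX, inner_smul_left, Complex.conj_ofReal, Complex.re_ofReal_mul]
  linear_combination (1 / 8) * hFu

theorem riemForm_eq_neg_fderiv_hopfPotential (h : CoordChangeAt φ z) (h0 : φ z ≠ 0)
    (hG : flatPullback φ z = Real.exp (hopfPotential φ z) • G z) {X : Cn n}
    (hX : fderiv ℂ φ z X = ((-(1 / 4) : ℝ) : ℂ) • φ z) :
    riemForm (G z) X = -(fderiv ℝ (hopfPotential φ) z : Cn n →ₗ[ℝ] ℝ) := by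
  ext u
  have hXu := h.re_sesq_flatPullback_eq h0 hX u
  rw [sesq_re_comm h.hermitianAt.posDef.isHermitian, hG, exp_hopfPotential h0, sesq_real_smul,
    Complex.re_ofReal_mul] at hXu
  rw [riemForm_apply, LinearMap.neg_apply, ContinuousLinearMap.coe_coe]
  refine mul_left_cancel₀ (pow_ne_zero 2 (norm_ne_zero_iff.2 h0)) ?_
  linear_combination 8 * hXu

theorem parallelAt_hopfPotential (h : CoordChangeAt φ z) (h0 : φ z ≠ 0)
    (hGd : ∀ i j, DifferentiableAt ℝ (fun w => G w i j) z)
    (hG : flatPullback φ =ᶠ[𝓝 z] fun w => Real.exp (hopfPotential φ w) • G w) {X : Cn n}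
    (hX : fderiv ℂ φ z X = ((-(1 / 4) : ℝ) : ℂ) • φ z) : ParallelAt G (hopfPotential φ) z X := by
  intro u v
  have hN : ‖φ z‖ ^ 2 ≠ 0 := pow_ne_zero 2 (norm_ne_zero_iff.2 h0)
  have hF := (contDiffAt_hopfPotential h.contDiff h0).differentiableAt (by norm_num)
  have hG_sesq (x y : Cn n) : (sesq (flatPullback φ z) x y).re =
      ‖φ z‖ ^ 2 / 4 * (sesq (G z) x y).re := by
    rw [hG.eq_of_nhds, exp_hopfPotential h0, sesq_real_smul, Complex.re_ofReal_mul]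
  have hFX : fderiv ℝ (hopfPotential φ) z X = -(1 / 2) := by
    have := norm_sq_mul_fderiv_hopfPotential h.differentiableAt h0 X
    rw [hX, inner_smul_right, Complex.re_ofReal_mul,
      show (inner ℂ (φ z) (φ z) : ℂ).re = ‖φ z‖ ^ 2 from inner_self_eq_norm_sq (𝕜 := ℂ) _] at this
    exact mul_left_cancel₀ hN (by linear_combination this)
  have hconf := koszul_conformal hGd hF hG u v X
  have hess := h.norm_sq_mul_hessian_hopfPotential h0 u v
  rw [h.koszul_flatPullback, hX, inner_smul_left, Complex.conj_ofReal, Complex.re_ofReal_mul,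
    exp_hopfPotential h0, hFX] at hconf
  have hu := h.re_sesq_flatPullback_eq h0 hX u
  have hv := h.re_sesq_flatPullback_eq h0 hX v
  have huv : (inner ℂ (fderiv ℂ φ z u) (fderiv ℂ φ z v) : ℂ).re =
      ‖φ z‖ ^ 2 / 4 * (sesq (G z) u v).re := by
    rw [← hG_sesq, sesq_re_comm h.hermitianAt.posDef.isHermitian, sesq_flatPullback]
  rw [hG_sesq] at hu hv
  refine mul_left_cancel₀ hN ?_
  linear_combination hess - 4 * hconf + 2 * huv - 4 * fderiv ℝ (hopfPotential φ) z u * hv -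
    4 * fderiv ℝ (hopfPotential φ) z v * hu

end CoordChangeAt

end FlatMetric

/-! ### Topology of the Hopf manifold -/

section HopfTopology

variable (α : HopfMultipliers n)

theorem isEmpty_hopf [IsEmpty (Fin n)] : IsEmpty (Hopf α) where
  false x := by
    obtain ⟨z, -⟩ := hopfProj_surjective α x
    exact z.2 (Subsingleton.elim _ _)

theorem locallyFinite_singleton_intCast : LocallyFinite fun k : ℤ => ({(k : ℝ)} : Set ℝ) := by
  refine fun x => ⟨Metric.ball x 1, Metric.ball_mem_nhds x one_pos,
    (Set.finite_Icc ⌊x - 1⌋ ⌈x + 1⌉).subset ?_⟩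
  rintro k ⟨_, rfl, hk⟩
  rw [Metric.mem_ball, Real.dist_eq, abs_lt] at hk
  exact ⟨Int.cast_le.1 ((Int.floor_le (x - 1)).trans (by linarith)),
    Int.cast_le.1 (le_trans (by linarith) (Int.le_ceil (x + 1)))⟩

theorem log_norm_scale (i : Fin n) (k : ℤ) {z : Cn n} (hz : z ≠ 0) :
    (Real.log ‖scale α k z‖ - Real.log ‖z‖) / Real.log ‖α.val i‖ = k := by
  have hlog : Real.log ‖α.val i‖ ≠ 0 :=
    (Real.log_neg (norm_pos_iff.2 (α.ne_zero i)) (α.norm_lt_one i)).ne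
  rw [norm_scale α i, Real.log_mul (zpow_ne_zero k (norm_ne_zero_iff.2 (α.ne_zero i)))
    (norm_ne_zero_iff.2 hz), Real.log_zpow, add_sub_cancel_right, mul_div_cancel_right₀ _ hlog]

theorem locallyFinite_graph_scale [Nonempty (Fin n)] :
    LocallyFinite fun k : ℤ => {q : punctured n × punctured n | (q.2 : Cn n) = scale α k q.1} := by
  let i : Fin n := Classical.arbitrary _
  have hlog : Continuous fun z : punctured n => Real.log ‖(z : Cn n)‖ :=
    Continuous.log (by fun_prop) fun z => norm_ne_zero_iff.2 z.2
  have hratio : Continuous fun q : punctured n × punctured n =>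
      (Real.log ‖(q.2 : Cn n)‖ - Real.log ‖(q.1 : Cn n)‖) / Real.log ‖α.val i‖ :=
    ((hlog.comp continuous_snd).sub (hlog.comp continuous_fst)).div_const _
  refine (locallyFinite_singleton_intCast.preimage_continuous hratio).subset fun k q hq => ?_
  rw [Set.mem_ofPred_eq] at hq
  rw [Set.mem_preimage, Set.mem_singleton_iff, hq, log_norm_scale α i k q.1.2]

theorem hopf_t2Space : T2Space (Hopf α) := by
  rcases isEmpty_or_nonempty (Fin n) with hn | hn
  · have := isEmpty_hopf α
    infer_instance
  rw [t2Space_iff_of_isOpenQuotientMap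
    ⟨hopfProj_surjective α, hopfProj_continuous α, hopfProj_isOpenMap α⟩]
  have hunion : {q : punctured n × punctured n | hopfProj α q.1 = hopfProj α q.2} =
      ⋃ k : ℤ, {q : punctured n × punctured n | (q.2 : Cn n) = scale α k q.1} := by
    ext q
    simp only [Set.mem_ofPred_eq, Set.mem_iUnion, hopfProj_eq_iff]
  rw [hunion]
  exact (locallyFinite_graph_scale α).isClosed_iUnion fun k => isClosed_eq (by fun_prop)
    ((scale_contDiff α k).continuous.comp (continuous_subtype_val.comp continuous_fst))

theorem isCompact_annulus {r : ℝ} (hr : 0 < r) (R : ℝ) :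
    IsCompact {z : punctured n | r ≤ ‖(z : Cn n)‖ ∧ ‖(z : Cn n)‖ ≤ R} := by
  rw [Subtype.isCompact_iff]
  have himage : Subtype.val '' {z : punctured n | r ≤ ‖(z : Cn n)‖ ∧ ‖(z : Cn n)‖ ≤ R} =
      Metric.closedBall (0 : Cn n) R ∩ {z | r ≤ ‖z‖} := by
    ext z
    simp only [Set.mem_image, Set.mem_inter_iff, mem_closedBall_zero_iff, Set.mem_ofPred_eq]
    constructor
    · rintro ⟨w, ⟨hw, hw'⟩, rfl⟩
      exact ⟨hw', hw⟩
    · rintro ⟨hz, hz'⟩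
      exact ⟨⟨z, norm_pos_iff.1 (hr.trans_le hz')⟩, ⟨hz', hz⟩, rfl⟩
  rw [himage]
  exact (isCompact_closedBall _ _).inter_right (isClosed_le continuous_const continuous_norm)

theorem exists_scale_mem_annulus (i : Fin n) {z : Cn n} (hz : z ≠ 0) :
    ∃ k : ℤ, ‖α.val i‖ ≤ ‖scale α k z‖ ∧ ‖scale α k z‖ ≤ 1 := by
  set ρ := ‖α.val i‖ with hρ
  have hρ0 : 0 < ρ := norm_pos_iff.2 (α.ne_zero i)
  obtain ⟨m, hm, hm'⟩ := exists_mem_Ico_zpow (norm_pos_iff.2 hz)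
    ((one_lt_inv₀ hρ0).2 (α.norm_lt_one i))
  rw [inv_zpow, inv_le_iff_one_le_mul₀' (zpow_pos hρ0 m)] at hm
  rw [inv_zpow, lt_inv_comm₀ (norm_pos_iff.2 hz) (zpow_pos hρ0 _)] at hm'
  refine ⟨m + 1, ?_, ?_⟩ <;> rw [norm_scale α i, ← hρ]
  · rw [zpow_add_one₀ hρ0.ne', mul_right_comm]
    exact le_mul_of_one_le_left hρ0.le hm
  · rw [← le_div_iff₀ (norm_pos_iff.2 hz), one_div]
    exact hm'.le

theorem hopf_compactSpace : CompactSpace (Hopf α) := by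
  rcases isEmpty_or_nonempty (Fin n) with hn | ⟨⟨i⟩⟩
  · have := isEmpty_hopf α
    infer_instance
  have himage := (isCompact_annulus (n := n) (norm_pos_iff.2 (α.ne_zero i)) 1).image
    (hopfProj_continuous α)
  refine ⟨himage.of_isClosed_subset isClosed_univ fun x _ => ?_⟩
  obtain ⟨z, rfl⟩ := hopfProj_surjective α x
  obtain ⟨k, hk⟩ := exists_scale_mem_annulus α i z.2
  exact ⟨⟨scale α k z, scale_ne_zero α k z.2⟩, hk, ((hopfProj_eq_iff α _ _).2 ⟨k, rfl⟩).symm⟩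

end HopfTopology

/-! ### The Hopf metric -/

section HopfMetric

variable {α : HopfMultipliers n}

/-- `scale α k` as a continuous linear map, hence its own derivative. -/
def scaleL (α : HopfMultipliers n) (k : ℤ) : Cn n →L[ℂ] Cn n :=
  LinearMap.toContinuousLinearMap
    { toFun := scale α k
      map_add' := fun u v => by ext i; simp [scale, mul_add]
      map_smul' := fun c u => by ext i; simp [scale, mul_left_comm] }

theorem nonempty_fin_of_ne_zero {p : Cn n} (hp : p ≠ 0) : Nonempty (Fin n) := by
  by_contra! h
  exact hp (Subsingleton.elim _ _)

theorem inner_scale (α : HopfMultipliers n) (i : Fin n) (k : ℤ) (u v : Cn n) :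
    inner ℂ (scale α k u) (scale α k v) = ((‖α.val i‖ ^ k) ^ 2 : ℝ) * inner ℂ u v := by
  rw [PiLp.inner_apply, PiLp.inner_apply, Finset.mul_sum]
  refine Finset.sum_congr rfl fun j _ => ?_
  have h : α.val j ^ k * conj (α.val j ^ k) = ((‖α.val i‖ ^ k) ^ 2 : ℝ) := by
    rw [Complex.mul_conj, Complex.normSq_eq_norm_sq, norm_zpow, α.norm_eq j i]
  simp only [scale, RCLike.inner_apply, map_mul]
  linear_combination v j * conj (u j) * h

/-- The point of `ℂⁿ ∖ {0}` over `x` singled out by the preferred chart at `x`. That chart also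
identifies the tangent space at `x` with `ℂⁿ`. -/
def basePoint (x : Hopf α) : Cn n := chartAt (Cn n) x x

theorem eq_hopfProj_of_mem_source {c : OpenPartialHomeomorph (Hopf α) (Cn n)}
    (hc : c ∈ atlas (Cn n) (Hopf α)) {x : Hopf α} (hx : x ∈ c.source) :
    ∃ h : c x ∈ punctured n, x = hopfProj α ⟨c x, h⟩ := by
  obtain ⟨h, h'⟩ := hopf_chart_symm α hc (c.map_source hx)
  exact ⟨h, (c.left_inv hx).symm.trans h'⟩

theorem eq_hopfProj_basePoint (x : Hopf α) :
    ∃ h : basePoint x ∈ punctured n, x = hopfProj α ⟨basePoint x, h⟩ :=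
  eq_hopfProj_of_mem_source (chart_mem_atlas _ x) (mem_chart_source _ x)

theorem hasMFDerivAt_chartAt_symm {M : Type*} [TopologicalSpace M] [ChartedSpace (Cn n) M]
    [IsManifold 𝓘(ℂ, Cn n) 1 M] (x : M) :
    HasMFDerivAt 𝓘(ℂ, Cn n) 𝓘(ℂ, Cn n) (chartAt (Cn n) x).symm (chartAt (Cn n) x x)
      (ContinuousLinearMap.id ℂ (Cn n)) := by
  have hd := (mdifferentiableAt_atlas_symm (I := 𝓘(ℂ, Cn n)) (chart_mem_atlas (Cn n) x)
    (mem_chart_target (Cn n) x)).hasMFDerivAt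
  have hid := mfderivWithin_range_extChartAt_symm (I := 𝓘(ℂ, Cn n)) (x := x)
  rw [ModelWithCorners.range_eq_univ, mfderivWithin_univ] at hid
  have hid : mfderiv 𝓘(ℂ, Cn n) 𝓘(ℂ, Cn n) (chartAt (Cn n) x).symm (chartAt (Cn n) x x) =
    ContinuousLinearMap.id ℂ (Cn n) := hid
  rwa [hid] at hd

theorem hasMFDerivAt_of_lift {X : Type*} [TopologicalSpace X] [ChartedSpace (Cn n) X]
    {ψ : X → Hopf α} {φ : X → Cn n} {x : X} {φ' : Cn n →L[ℂ] Cn n}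
    (hφ : HasMFDerivAt 𝓘(ℂ, Cn n) 𝓘(ℂ, Cn n) φ x φ')
    (hlift : ∀ᶠ y in 𝓝 x, ∃ h : φ y ∈ punctured n, ψ y = hopfProj α ⟨φ y, h⟩) :
    ∃ k : ℤ, basePoint (ψ x) = scale α k (φ x) ∧
      HasMFDerivAt 𝓘(ℂ, Cn n) 𝓘(ℂ, Cn n) ψ x ((scaleL α k).comp φ') := by
  obtain ⟨_, hx⟩ := hlift.self_of_nhds
  obtain ⟨_, hx'⟩ := eq_hopfProj_basePoint (ψ x)
  obtain ⟨k, hk : basePoint (ψ x) = scale α k (φ x)⟩ :=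
    (hopfProj_eq_iff α _ _).1 (hx.symm.trans hx')
  refine ⟨k, hk, ?_⟩
  set c := chartAt (Cn n) (ψ x)
  have hscale : HasMFDerivAt 𝓘(ℂ, Cn n) 𝓘(ℂ, Cn n) (scale α k) (φ x) (scaleL α k) :=
    (scaleL α k).hasFDerivAt.hasMFDerivAt
  have hsymm : HasMFDerivAt 𝓘(ℂ, Cn n) 𝓘(ℂ, Cn n) c.symm (scale α k (φ x))
      (ContinuousLinearMap.id ℂ (Cn n)) := by
    have : IsManifold 𝓘(ℂ, Cn n) 1 (Hopf α) := IsManifold.of_le (n := ω) le_top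
    rw [← hk]
    exact hasMFDerivAt_chartAt_symm (ψ x)
  have hk_mem : scale α k (φ x) ∈ c.target := hk ▸ mem_chart_target (Cn n) (ψ x)
  have htarget : ∀ᶠ y in 𝓝 x, scale α k (φ y) ∈ c.target :=
    ((scale_contDiff α k).continuous.continuousAt.comp hφ.1).preimage_mem_nhds
      (c.open_target.mem_nhds hk_mem)
  refine (hsymm.comp x (hscale.comp x hφ)).congr_of_eventuallyEq ?_
  filter_upwards [hlift, htarget] with y ⟨_, hy⟩ hyt
  obtain ⟨_, hy'⟩ := hopf_chart_symm α (chart_mem_atlas (Cn n) (ψ x)) hyt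
  rw [hy]
  exact ((hopfProj_eq_iff α _ _).2 ⟨k, rfl⟩).trans hy'.symm

/-- The value at `x` of the metric `4 √-1 ∂∂̄|z|² / |z|²`. -/
def hopfForm (x : Hopf α) : Cn n →ₗ[ℂ] Cn n →ₗ⋆[ℂ] ℂ :=
  ((4 / ‖basePoint x‖ ^ 2 : ℝ) : ℂ) • (innerₛₗ ℂ).flip

theorem hopfForm_apply (x : Hopf α) (u v : Cn n) :
    hopfForm x u v = ((4 / ‖basePoint x‖ ^ 2 : ℝ) : ℂ) * inner ℂ v u := rfl

theorem conj_hopfForm (x : Hopf α) (u v : Cn n) : conj (hopfForm x u v) = hopfForm x v u := by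
  rw [hopfForm_apply, hopfForm_apply, map_mul, Complex.conj_ofReal, inner_conj_symm]

theorem hopfForm_self_re_pos (x : Hopf α) {u : Cn n} (hu : u ≠ 0) : 0 < (hopfForm x u u).re := by
  have hx : 0 < ‖basePoint x‖ := norm_pos_iff.2 (eq_hopfProj_basePoint x).1
  have hinner : 0 < (inner ℂ u u : ℂ).re := re_inner_self_pos (𝕜 := ℂ) |>.2 hu
  rw [hopfForm_apply, Complex.re_ofReal_mul]
  positivity

/-- The value at `x` of the Lee form `-d log |z|²` of the Hopf metric. -/
def hopfLeeForm (x : Hopf α) : Cn n →ₗ[ℝ] ℝ :=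
  (-(2 / ‖basePoint x‖ ^ 2)) •
    Complex.reLm ∘ₗ ((innerSL ℂ (basePoint x)) : Cn n →ₗ[ℂ] ℂ).restrictScalars ℝ

theorem hopfLeeForm_apply (x : Hopf α) (u : Cn n) :
    hopfLeeForm x u = -(2 / ‖basePoint x‖ ^ 2) * (inner ℂ (basePoint x) u : ℂ).re := rfl

section Scale

variable {x : Hopf α} {p : Cn n} {k : ℤ}

theorem hopfForm_scale (hp : p ≠ 0) (hx : basePoint x = scale α k p) (u v : Cn n) :
    hopfForm x (scale α k u) (scale α k v) = ((4 / ‖p‖ ^ 2 : ℝ) : ℂ) * inner ℂ v u := by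
  obtain ⟨i⟩ := nonempty_fin_of_ne_zero hp
  have hρ : ‖α.val i‖ ^ k ≠ 0 := zpow_ne_zero k (norm_ne_zero_iff.2 (α.ne_zero i))
  have hp' := norm_ne_zero_iff.2 hp
  have hcancel : 4 / (‖α.val i‖ ^ k * ‖p‖) ^ 2 * (‖α.val i‖ ^ k) ^ 2 = 4 / ‖p‖ ^ 2 := by
    field_simp
  rw [hopfForm_apply, hx, inner_scale α i, norm_scale α i, ← mul_assoc, ← Complex.ofReal_mul,
    hcancel]

theorem hopfLeeForm_scale (hp : p ≠ 0) (hx : basePoint x = scale α k p) (u : Cn n) :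
    hopfLeeForm x (scale α k u) = -(2 / ‖p‖ ^ 2) * (inner ℂ p u : ℂ).re := by
  obtain ⟨i⟩ := nonempty_fin_of_ne_zero hp
  have hρ : ‖α.val i‖ ^ k ≠ 0 := zpow_ne_zero k (norm_ne_zero_iff.2 (α.ne_zero i))
  have hp' := norm_ne_zero_iff.2 hp
  rw [hopfLeeForm_apply, hx, inner_scale α i, norm_scale α i, Complex.re_ofReal_mul]
  field_simp

end Scale

/-- Near `z`, the inverse of the chart `e` lifts holomorphically to `ℂⁿ ∖ {0}` as `φ`. -/
structure HopfLiftAt (e : OpenPartialHomeomorph (Hopf α) (Cn n)) (φ : Cn n → Cn n) (z : Cn n) :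
    Prop where
  contDiff : ContDiffAt ℂ ω φ z
  eventually_eq : ∀ᶠ w in 𝓝 z, ∃ h : φ w ∈ punctured n, e.symm w = hopfProj α ⟨φ w, h⟩

variable {e : OpenPartialHomeomorph (Hopf α) (Cn n)} {φ : Cn n → Cn n}

theorem exists_hopfLiftAt (he : e ∈ holoCharts n (Hopf α)) (hz : z ∈ e.target) :
    ∃ φ, HopfLiftAt e φ z := by
  set c := chartAt (Cn n) (e.symm z)
  have hc : c ∈ holoCharts n (Hopf α) := IsManifold.chart_mem_maximalAtlas _
  have hsource : e.symm z ∈ c.source := mem_chart_source (Cn n) (e.symm z)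
  refine ⟨c ∘ e.symm, ((contMDiffAt_of_mem_maximalAtlas hc hsource).comp z
    (contMDiffAt_symm_of_mem_maximalAtlas he hz)).contDiffAt, ?_⟩
  filter_upwards [(e.continuousAt_symm hz).preimage_mem_nhds (c.open_source.mem_nhds hsource)]
    with w hw using eq_hopfProj_of_mem_source (chart_mem_atlas _ _) hw

namespace HopfLiftAt

theorem eventually (h : HopfLiftAt e φ z) : ∀ᶠ w in 𝓝 z, HopfLiftAt e φ w := by
  filter_upwards [h.contDiff.eventually (by simp), h.eventually_eq.eventually_nhds] with w hw hw'
    using ⟨hw, hw'⟩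

theorem ne_zero (h : HopfLiftAt e φ z) : φ z ≠ 0 := h.eventually_eq.self_of_nhds.1

theorem exists_scale (h : HopfLiftAt e φ z) :
    ∃ k : ℤ, basePoint (e.symm z) = scale α k (φ z) ∧
      ∀ u, tangentOf e z u = scale α k (fderiv ℂ φ z u) := by
  obtain ⟨k, hk, hd⟩ := hasMFDerivAt_of_lift (ψ := e.symm)
    (h.contDiff.differentiableAt (by simp)).hasFDerivAt.hasMFDerivAt h.eventually_eq
  exact ⟨k, hk, fun u => congrArg (fun L : Cn n →L[ℂ] Cn n => L u) hd.mfderiv⟩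

theorem hopfForm_eq (h : HopfLiftAt e φ z) (u v : Cn n) :
    hopfForm (e.symm z) (tangentOf e z u) (tangentOf e z v) =
      ((4 / ‖φ z‖ ^ 2 : ℝ) : ℂ) * inner ℂ (fderiv ℂ φ z v) (fderiv ℂ φ z u) := by
  obtain ⟨k, hk, htan⟩ := h.exists_scale
  rw [htan, htan]
  exact hopfForm_scale h.ne_zero hk _ _

theorem hopfLeeForm_eq (h : HopfLiftAt e φ z) (u : Cn n) :
    hopfLeeForm (e.symm z) (tangentOf e z u) =
      -(2 / ‖φ z‖ ^ 2) * (inner ℂ (φ z) (fderiv ℂ φ z u) : ℂ).re := by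
  obtain ⟨k, hk, htan⟩ := h.exists_scale
  rw [htan]
  exact hopfLeeForm_scale h.ne_zero hk _

theorem coordChangeAt (h : HopfLiftAt e φ z) (he : e ∈ holoCharts n (Hopf α))
    (hz : z ∈ e.target) : CoordChangeAt φ z where
  contDiff := h.contDiff
  invertible := by
    obtain ⟨k, -, htan⟩ := h.exists_scale
    have hinj : Function.Injective (fderiv ℂ φ z : Cn n →ₗ[ℂ] Cn n) := fun u v huv =>
      tangentOf_injective he hz (((htan u).trans (congrArg (scale α k) huv)).trans (htan v).symm)
    exact ⟨(LinearEquiv.ofInjectiveEndo _ hinj).toContinuousLinearEquiv, by ext; rfl⟩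

theorem contDiffAt_fderiv_apply (h : HopfLiftAt e φ z) (u : Cn n) :
    ContDiffAt ℝ ∞ (fun w => fderiv ℂ φ w u) z :=
  (((h.contDiff.fderiv_right (m := ω) (by simp)).clm_apply contDiffAt_const).restrict_scalars
    ℝ).of_le le_top

theorem contDiffAt_norm_sq (h : HopfLiftAt e φ z) : ContDiffAt ℝ ∞ (fun w => ‖φ w‖ ^ 2) z :=
  ((h.contDiff.restrict_scalars ℝ).of_le le_top).norm_sq ℂ

theorem norm_sq_ne_zero (h : HopfLiftAt e φ z) : ‖φ z‖ ^ 2 ≠ 0 :=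
  pow_ne_zero 2 (norm_ne_zero_iff.2 h.ne_zero)

end HopfLiftAt

/-- The metric `4 √-1 ∂∂̄|z|² / |z|²` on the Hopf manifold. -/
def hopfMetric (α : HopfMultipliers n) : HermitianMetric n (Hopf α) where
  form := hopfForm
  conj_symm x := conj_hopfForm x
  pos x _ hu := hopfForm_self_re_pos x hu
  smooth e he i j z hz := by
    obtain ⟨φ, hφ⟩ := exists_hopfLiftAt he hz
    have hc : ContDiffAt ℝ ∞ (fun w => ((4 / ‖φ w‖ ^ 2 : ℝ) : ℂ)) z :=
      Complex.ofRealCLM.contDiff.contDiffAt.comp z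
        (contDiffAt_const.div hφ.contDiffAt_norm_sq hφ.norm_sq_ne_zero)
    exact ((hc.mul ((hφ.contDiffAt_fderiv_apply _).inner ℂ
      (hφ.contDiffAt_fderiv_apply _))).congr_of_eventuallyEq
        (hφ.eventually.mono fun w hw => hw.hopfForm_eq _ _)).contDiffWithinAt

/-- The Lee form `-d log |z|²` of the Hopf metric. -/
def hopfLee (α : HopfMultipliers n) : RealOneForm n (Hopf α) where
  form := hopfLeeForm
  smooth e he a z hz := by
    obtain ⟨φ, hφ⟩ := exists_hopfLiftAt he hz
    have hφ' : ContDiffAt ℝ ∞ φ z := (hφ.contDiff.restrict_scalars ℝ).of_le le_top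
    have hinner : ContDiffAt ℝ ∞ (fun w => (inner ℂ (φ w) (fderiv ℂ φ w (realVec a)) : ℂ).re) z :=
      Complex.reCLM.contDiff.contDiffAt.comp z (hφ'.inner ℂ (hφ.contDiffAt_fderiv_apply _))
    exact (((contDiffAt_const.div hφ.contDiffAt_norm_sq hφ.norm_sq_ne_zero).neg.mul
      hinner).congr_of_eventuallyEq
        (hφ.eventually.mono fun w hw => hw.hopfLeeForm_eq _)).contDiffWithinAt

theorem hasMFDerivAt_punctured_val (z : punctured n) :
    HasMFDerivAt 𝓘(ℂ, Cn n) 𝓘(ℂ, Cn n) (Subtype.val : punctured n → Cn n) z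
      (ContinuousLinearMap.id ℂ (Cn n)) := by
  have h := TopologicalSpace.Opens.chartAt_subtype_val_symm_eventuallyEq (H := Cn n)
    (punctured n) (x := z)
  exact ⟨continuous_subtype_val.continuousAt, (hasFDerivWithinAt_id _ _).congr_of_eventuallyEq
    (h.symm.filter_mono nhdsWithin_le_nhds) h.symm.self_of_nhds⟩

theorem hopfMetric_hopfProj (α : HopfMultipliers n) (z : punctured n) (u v : Cn n) :
    (hopfMetric α).form (hopfProj α z)
      (mfderiv 𝓘(ℂ, Cn n) 𝓘(ℂ, Cn n) (hopfProj α) z u)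
      (mfderiv 𝓘(ℂ, Cn n) 𝓘(ℂ, Cn n) (hopfProj α) z v) =
    4 * (∑ i, u i * conj (v i)) / (‖(z : Cn n)‖ ^ 2 : ℝ) := by
  obtain ⟨k, hk, hd⟩ := hasMFDerivAt_of_lift (ψ := hopfProj α) (hasMFDerivAt_punctured_val z)
    (.of_forall fun y => ⟨y.2, rfl⟩)
  rw [hd.mfderiv]
  refine (hopfForm_scale z.2 hk u v).trans ?_
  rw [PiLp.inner_apply, Complex.ofReal_div, div_mul_eq_mul_div]
  rfl

theorem HopfLiftAt.flatPullback_eq (h : HopfLiftAt e φ z) :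
    flatPullback φ =ᶠ[𝓝 z] fun w => Real.exp (hopfPotential φ w) • (hopfMetric α).coord e w := by
  filter_upwards [h.eventually] with w hw
  ext i j
  have hnorm : ((‖φ w‖ : ℝ) : ℂ) ≠ 0 := Complex.ofReal_ne_zero.2 (norm_ne_zero_iff.2 hw.ne_zero)
  have hcoord : (hopfMetric α).coord e w i j =
      ((4 / ‖φ w‖ ^ 2 : ℝ) : ℂ) * flatPullback φ w i j := hw.hopfForm_eq _ _
  rw [Matrix.smul_apply, hcoord, exp_hopfPotential hw.ne_zero, Complex.real_smul]
  push_cast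
  field_simp

theorem HopfLiftAt.hopfLee_coord_eq (h : HopfLiftAt e φ z) (a : Fin n ⊕ Fin n) :
    (hopfLee α).coord e z a = -fderiv ℝ (hopfPotential φ) z (realVec a) := by
  have hF := norm_sq_mul_fderiv_hopfPotential (h.contDiff.differentiableAt (by simp)) h.ne_zero
    (realVec a)
  refine (h.hopfLeeForm_eq (realVec a)).trans ?_
  rw [neg_mul, neg_inj, div_mul_eq_mul_div, div_eq_iff h.norm_sq_ne_zero]
  linear_combination -hF

theorem isLeeForm_hopfLee (α : HopfMultipliers n) : IsLeeForm (hopfMetric α) (hopfLee α) := by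
  intro e he z hz
  obtain ⟨φ, hφ⟩ := exists_hopfLiftAt he hz
  have hcoord := hφ.coordChangeAt he hz
  have hG := ((hopfMetric α).hermitianAt_coord he hz).differentiableAt
  have hF := contDiffAt_hopfPotential hφ.contDiff hφ.ne_zero
  have hθ := hφ.eventually.mono fun w hw => hw.hopfLee_coord_eq
  constructor
  · intro a b
    have hdF := differentiableAt_fderiv hF
    rw [dCovector, dR_neg_fderiv hdF hθ, dR_neg_fderiv hdF hθ, fderiv_fderiv_comm hF, sub_self]
  · have hlee := hcoord.leeAt_zero.of_conformal hG (hF.differentiableAt (by simp))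
      hφ.flatPullback_eq
    rw [zero_sub] at hlee
    exact (leeAt_iff hG hθ.self_of_nhds).1 hlee

theorem isParallel_hopfLee (α : HopfMultipliers n) : IsParallel (hopfMetric α) (hopfLee α) := by
  intro e he z hz
  obtain ⟨φ, hφ⟩ := exists_hopfLiftAt he hz
  have hcoord := hφ.coordChangeAt he hz
  have hG := (hopfMetric α).hermitianAt_coord he hz
  obtain ⟨X, hX⟩ := hcoord.invertible.surjective (((-(1 / 4) : ℝ) : ℂ) • φ z)
  exact (parallelAt_iff hG.differentiableAt hG.posDef
    (differentiableAt_fderiv (contDiffAt_hopfPotential hφ.contDiff hφ.ne_zero))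
    (hφ.eventually.mono fun w hw => hw.hopfLee_coord_eq)
    (hcoord.riemForm_eq_neg_fderiv_hopfPotential hφ.ne_zero hφ.flatPullback_eq.eq_of_nhds hX)).1
    (hcoord.parallelAt_hopfPotential hφ.ne_zero hG.differentiableAt hφ.flatPullback_eq hX)

theorem qNonneg_hopfMetric (α : HopfMultipliers n) : QNonneg (hopfMetric α) := by
  intro e he z hz
  obtain ⟨φ, hφ⟩ := exists_hopfLiftAt he hz
  have hcoord := hφ.coordChangeAt he hz
  refine qNonnegAt_of_conformal_kahler ((hopfMetric α).hermitianAt_coord he hz)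
    hcoord.hermitianAt hφ.flatPullback_eq (θ := (hopfLee α).coord e) ?_
    (isParallel_hopfLee α e he z hz) ?_ ?_
  · filter_upwards [e.open_target.mem_nhds hz] with w hw using (isLeeForm_hopfLee α e he w hw).2
  · filter_upwards [hcoord.eventually] with w hw a b c
    rw [(leeAt_iff hw.hermitianAt.differentiableAt (θ := 0) fun _ => rfl).1 hw.leeAt_zero]
    simp [wedgeFund]
  · intro ε _ lam
    simp [evalDiag, hcoord.chernCurv_flatPullback]

end HopfMetric

end QPositivity

end

theorem mainTheorem5_general :
    (∀ (n : ℕ) (M : Type*) [TopologicalSpace M] [ChartedSpace (Cn n) M]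
        (N : Type*) [TopologicalSpace N] [ChartedSpace (Cn n) N] [IsManifold 𝓘(ℂ, Cn n) ω N]
        (π : N → M) (f : N → ℝ) (g : HermitianMetric n M) (g' : HermitianMetric n N),
        IsVaisman g → Function.Surjective π →
        IsLocalDiffeomorph 𝓘(ℂ, Cn n) 𝓘(ℂ, Cn n) ω π → IsKahler g' →
        (∀ (x : N) (u v : TangentSpace 𝓘(ℂ, Cn n) x),
          g'.form x u v = (Real.exp (f x) : ℂ) * g.form (π x)
            (mfderiv 𝓘(ℂ, Cn n) 𝓘(ℂ, Cn n) π x u) (mfderiv 𝓘(ℂ, Cn n) 𝓘(ℂ, Cn n) π x v)) →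
        NonnegQuadOrthBisectional g' → QNonneg g) ∧
    (∀ (n : ℕ) (α : HopfMultipliers n),
        T2Space (Hopf α) ∧ CompactSpace (Hopf α) ∧
        ∃ g : HermitianMetric n (Hopf α),
          (∀ (z : punctured n) (u v : Cn n),
            g.form (hopfProj α z)
                (mfderiv 𝓘(ℂ, Cn n) 𝓘(ℂ, Cn n) (hopfProj α) z u)
                (mfderiv 𝓘(ℂ, Cn n) 𝓘(ℂ, Cn n) (hopfProj α) z v) =
              4 * (∑ i, u i * conj (v i)) / (‖(z : Cn n)‖ ^ 2 : ℝ)) ∧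
          IsVaisman g ∧ QNonneg g) :=
  ⟨fun _ _ _ _ _ _ _ _ _ _ _ _ hg hsurj hπ hg' hf hR =>
      qNonneg_of_conformal_kahler hg hsurj hπ hg' hf hR,
    fun _ α => ⟨hopf_t2Space α, hopf_compactSpace α, hopfMetric α, hopfMetric_hopfProj α,
      ⟨hopfLee α, isLeeForm_hopfLee α, isParallel_hopfLee α⟩, qNonneg_hopfMetric α⟩⟩

theorem mainTheorem5 :
    (∀ (n : ℕ) (M : Type*) [TopologicalSpace M] [T2Space M] [CompactSpace M]
        [ChartedSpace (Cn n) M] [IsManifold 𝓘(ℂ, Cn n) ω M]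
        (N : Type*) [TopologicalSpace N] [ChartedSpace (Cn n) N] [IsManifold 𝓘(ℂ, Cn n) ω N]
        (π : N → M) (g : HermitianMetric n M) (g' : HermitianMetric n N),
        IsVaisman g → IsKahlerCover π g g' → NonnegQuadOrthBisectional g' → QNonneg g) ∧
    (∀ (n : ℕ) (α : HopfMultipliers n),
        T2Space (Hopf α) ∧ CompactSpace (Hopf α) ∧
        ∃ g : HermitianMetric n (Hopf α),
          (∀ (z : punctured n) (u v : Cn n),
            g.form (hopfProj α z)
                (mfderiv 𝓘(ℂ, Cn n) 𝓘(ℂ, Cn n) (hopfProj α) z u)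
                (mfderiv 𝓘(ℂ, Cn n) 𝓘(ℂ, Cn n) (hopfProj α) z v) =
              4 * (∑ i, u i * conj (v i)) / (‖(z : Cn n)‖ ^ 2 : ℝ)) ∧
          IsVaisman g ∧ QNonneg g) := by
  obtain ⟨hcover, hhopf⟩ := mainTheorem5_general
  exact ⟨fun n M _ _ _ _ _ N _ _ _ π g g' hg hC hR => hC.conformal.elim fun f hf =>
    hcover n M N π f g g' hg hC.surjective hC.holomorphic hC.kahler hf hR, hhopf⟩
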